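/- Let $\mathcal A$ be a finite alphabet and let $(E,\mathcal L)$ be a left-resolving labelled graph over $\mathcal A$: $E=(E^0,E^1,r,s)$ is a directed graph (with arbitrary sets of vertices and edges) in which every vertex emits and receives an edge, and $\mathcal L:E^1\to\mathcal A$ is a map which is injective on $r^{-1}(v)$ for each $v\in E^0$. Let $\mathcal L^*(E)$ be the set of labels $\alpha=\mathcal L(e_1)\cdots\mathcal L(e_n)$ of paths $e_1\cdots e_n$, $n\ge 1$, and for $X\subseteq E^0$ let $r(X,\alpha)$ be the set of ranges of the paths with label $\alpha$ and source in $X$; put $r(\alpha)=r(E^0,\alpha)$. Let $\mathcal E^{0,-}$ be the smallest collection of subsets of $E^0$ which contains $r(\alpha)$ for all $\alpha\in\mathcal L^*(E)$ and is closed under finite intersections, finite unions and $X\mapsto r(X,\alpha)$ for all $\alpha\in\mathcal L^*(E)$. Let $C^*(E,\mathcal L,\mathcal E^{0,-})$ be the universal $C^*$-algebra generated by projections $p_X$, $X\in\mathcal E^{0,-}$, and partial isometries $s_a$, $a\in\mathcal A$, such that (with $p_\emptyset=0$) for $X,Y\in\mathcal E^{0,-}$ and $a,b\in\mathcal A$: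 (i) $p_Xp_Y=p_{X\cap Y}$ and $p_{X\cup Y}=p_X+p_Y-p_{X\cap Y}$; (ii) $p_Xs_a=s_ap_{r(X,a)}$; (iii) $s_a^*s_a=p_{r(a)}$, and $s_a^*s_b=0$ if $a\ne b$; (iv) $p_X=\sum_{a}s_ap_{r(X,a)}s_a^*$, where the sum is over the labels $a$ of the edges with source in $X$. For $\ell\ge1$ write $v\sim_\ell w$ if $v,w\in E^0$ receive the same labelled paths of length at least $1$ and at most $\ell$, let $[v]_\ell$ be the class of $v$, and let $\Omega_\ell$ be the finite set of these classes. For $P\in\Omega_\ell$ and $Q\in\Omega_{\ell+1}$ let $I(E)_{\ell,\ell+1}(P,Q)$ be $1$ if $Q\subseteq P$ and $0$ otherwise, and let $M(E)_{\ell,\ell+1}(P,Q)$ be the formal sum $\sum_e\mathcal L(e)$ over all edges $e$ with $s(e)\in P$ and $r(e)=w$, where $w$ is any vertex in $Q$ (the sum does not depend on the choice of $w$). Then $(M(E)_{\ell,\ell+1},I(E)_{\ell,\ell+1})_{\ell\ge1}$ is an essential symbolic matrix system. Let $\mathfrak L_{E,\mathcal L}$ be the associated $\lambda$-graph system: its vertices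 at level $\ell$ are the elements of $\Omega_\ell$, the number of its edges with label $a$ from $P\in\Omega_\ell$ to $Q\in\Omega_{\ell+1}$ is the multiplicity of $a$ in $M(E)_{\ell,\ell+1}(P,Q)$, and its map $\iota:\Omega_{\ell+1}\to\Omega_\ell$ sends $Q$ to the unique $P$ with $I(E)_{\ell,\ell+1}(P,Q)=1$. Let $\mathcal O_{\mathfrak L_{E,\mathcal L}}$ be its $C^*$-algebra, that is, the universal unital $C^*$-algebra generated by partial isometries $t_a$, $a\in\mathcal A$, and projections $E_P^\ell$, $\ell\ge1$, $P\in\Omega_\ell$, such that for all $\ell$, $P\in\Omega_\ell$ and $a$: $$\sum_{b\in\mathcal A}t_bt_b^*=1,\qquad \sum_{R\in\Omega_\ell}E_R^\ell=1,\qquad E_P^\ell=\sum_{Q\in\Omega_{\ell+1}}I(E)_{\ell,\ell+1}(P,Q)\,E_Q^{\ell+1},$$ $$t_at_a^*E_P^\ell=E_P^\ell t_at_a^*,\qquad t_a^*E_P^\ell t_a=\sum_{Q\in\Omega_{\ell+1}}A_{\ell,\ell+1}(P,a,Q)\,E_Q^{\ell+1},$$ where $A_{\ell,\ell+1}(P,a,Q)$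 is $1$ if $a$ occurs in $M(E)_{\ell,\ell+1}(P,Q)$ and $0$ otherwise. Then $C^*(E,\mathcal L,\mathcal E^{0,-})\cong\mathcal O_{\mathfrak L_{E,\mathcal L}}$ as $C^*$-algebras. -/

import Mathlib

universe u v

open scoped ENNReal

noncomputable section

/-! ### Universal C⋆-algebras given by generators and relations -/

/-- A partial isometry in a C⋆-algebra. -/
def IsPartialIsometry {B : Type u} [Mul B] [Star B] (x : B) : Prop :=
  x * star x * x = x

theorem IsPartialIsometry.norm_le {B : Type u} [NonUnitalCStarAlgebra B] {x : B}
    (hx : IsPartialIsometry x) : ‖x‖ ≤ 1 := by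
  have hp : IsStarProjection (star x * x) := by
    refine ⟨?_, ?_⟩
    · change star x * x * (star x * x) = star x * x
      have h : x * star x * x = x := hx
      rw [mul_assoc, ← mul_assoc x, h]
    · change star (star x * x) = star x * x
      simp
  have h1 : ‖star x * x‖ ≤ 1 := hp.norm_le
  rw [CStarRing.norm_star_mul_self] at h1
  nlinarith [norm_nonneg x]

/-- The C⋆-subalgebra generated by a set of elements of the ℓ^∞-product of a family `B` of
C⋆-algebras.  It is used with `B` indexed by *all* representations of a given system of generators
and relations, and with the set of all tuples `(image of g under the i-th representation)_i`, for `g`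
a generator: this is the standard construction of the universal C⋆-algebra with these generators
and relations, as every representation factors uniquely through it, by a coordinate projection.

The representations considered live in C⋆-algebras in the universe `u` which also contains the
generators.  This is no restriction, since a C⋆-algebra generated by the image of a set in `Type u`
is isomorphic to one in `Type u`. -/
def generatedCStarAlgebra {ι : Type v} (B : ι → Type u) [∀ i, NonUnitalCStarAlgebra (B i)]
    (gens : Set (lp B ∞)) : NonUnitalStarSubalgebra ℂ (lp B ∞) :=
  (NonUnitalStarAlgebra.adjoin ℂ gens).topologicalClosure

/-! ### Labelled graphs -/

/-- A directed graph `(E⁰, E¹, r, s)` together with a labelling `E¹ → A` of its edges. -/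
structure LabelledGraph (A : Type u) where
  /-- the vertices -/
  V : Type u
  /-- the edges -/
  Edge : Type u
  /-- the source map -/
  s : Edge → V
  /-- the range map -/
  r : Edge → V
  /-- the labelling -/
  label : Edge → A

namespace LabelledGraph

variable {A : Type u} (E : LabelledGraph A)

/-- Every vertex emits and receives an edge. -/
def Essential : Prop := ∀ v : E.V, (∃ e, E.s e = v) ∧ (∃ e, E.r e = v)

/-- Distinct edges with the same range have distinct labels. -/
def LeftResolving : Prop := ∀ e f : E.Edge, E.r e = E.r f → E.label e = E.label f → e = f

/-- `E.Path v α w`: there is a path `e₁ … eₙ` in the graph with source `v`, range `w` and label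
`α = 𝓛(e₁) … 𝓛(eₙ)`.  (For `n = 0` this is the path of length zero at a vertex.) -/
inductive Path : E.V → List A → E.V → Prop
  | nil (v : E.V) : Path v [] v
  | cons (e : E.Edge) {α : List A} {w : E.V} (h : Path (E.r e) α w) :
      Path (E.s e) (E.label e :: α) w

/-- The set `𝓛*(E)` of labelled paths of length at least one. -/
def labelledPaths : Set (List A) := {α | α ≠ [] ∧ ∃ v w, E.Path v α w}

/-- The range `r(α)` of a labelled path. -/
def range (α : List A) : Set E.V := {w | ∃ v, E.Path v α w}

/-- The relative range `r(X, α)` of a labelled path with respect to a set of vertices. -/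
def relRange (X : Set E.V) (α : List A) : Set E.V := {w | ∃ v ∈ X, E.Path v α w}

/-- The set `L¹_X` of labels of the edges whose source is in `X`. -/
def emittedLabels (X : Set E.V) : Set A := {a | ∃ e, E.s e ∈ X ∧ E.label e = a}

/-- A collection of sets of vertices is accommodating if it is closed under relative ranges, contains
all the ranges of labelled paths, and is closed under finite intersections and unions. -/
structure IsAccommodating (𝓑 : Set (Set E.V)) : Prop where
  relRange_mem : ∀ X ∈ 𝓑, ∀ α ∈ E.labelledPaths, E.relRange X α ∈ 𝓑
  range_mem : ∀ α ∈ E.labelledPaths, E.range α ∈ 𝓑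
  inter_mem : ∀ X ∈ 𝓑, ∀ Y ∈ 𝓑, X ∩ Y ∈ 𝓑
  union_mem : ∀ X ∈ 𝓑, ∀ Y ∈ 𝓑, X ∪ Y ∈ 𝓑

/-- The smallest accommodating collection `𝓔^{0,-}`. -/
def smallestAccommodating : Set (Set E.V) := ⋂₀ {𝓑 | E.IsAccommodating 𝓑}

/-- The collection `𝓔^{0,-} ∪ {∅}` which indexes the projections of a representation.  (The
relations below refer to `p_∅`, and require it to be `0`, even if `∅` is not in `𝓔^{0,-}`.) -/
def projectionSets : Set (Set E.V) := insert ∅ E.smallestAccommodating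

/-- Representations of the labelled space `(E, 𝓛, 𝓔^{0,-})` in a C⋆-algebra `B`:
projections `p_X` and partial isometries `s_a` satisfying the Cuntz-Krieger type relations of a
labelled space.  All the intersections, unions, ranges and relative ranges which occur in the relations
are again in `𝓔^{0,-} ∪ {∅}`.  (The sum in the last relation is finite for set-finite labelled spaces, in
particular over finite alphabets.) -/
structure IsRepresentation {B : Type u} [NonUnitalCStarAlgebra B]
    (p : E.projectionSets → B) (S : A → B) : Prop where
  projection : ∀ X, IsStarProjection (p X)
  partialIsometry : ∀ a, IsPartialIsometry (S a)
  empty : ∀ X : E.projectionSets, X.1 = ∅ → p X = 0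
  inter : ∀ X Y Z : E.projectionSets, Z.1 = X.1 ∩ Y.1 → p X * p Y = p Z
  union : ∀ X Y Z W : E.projectionSets, Z.1 = X.1 ∩ Y.1 → W.1 = X.1 ∪ Y.1 →
    p W = p X + p Y - p Z
  proj_mul : ∀ (a : A) (X Y : E.projectionSets), Y.1 = E.relRange X.1 [a] →
    p X * S a = S a * p Y
  star_mul_self : ∀ (a : A) (X : E.projectionSets), X.1 = E.range [a] →
    star (S a) * S a = p X
  star_mul : ∀ a b : A, a ≠ b → star (S a) * S b = 0
  sum : ∀ (X : E.projectionSets) (Y : A → E.projectionSets),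
    (∀ a, (Y a).1 = E.relRange X.1 [a]) →
    p X = ∑ᶠ a ∈ E.emittedLabels X.1, S a * p (Y a) * star (S a)

/-- A C⋆-algebra together with a representation of the labelled space in it. -/
structure Representation where
  carrier : Type u
  [cstar : NonUnitalCStarAlgebra carrier]
  p : E.projectionSets → carrier
  S : A → carrier
  isRepresentation : E.IsRepresentation p S

attribute [instance] Representation.cstar

/-- The generator `p_X` of `C⋆(E, 𝓛, 𝓔^{0,-})`. -/
def universalP (X : E.projectionSets) : lp (fun R : E.Representation => R.carrier) ∞ :=
  ⟨fun R => R.p X, memℓp_infty ⟨1, by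
    rintro _ ⟨R, rfl⟩
    exact (R.isRepresentation.projection X).norm_le⟩⟩

/-- The generator `s_a` of `C⋆(E, 𝓛, 𝓔^{0,-})`. -/
def universalS (a : A) : lp (fun R : E.Representation => R.carrier) ∞ :=
  ⟨fun R => R.S a, memℓp_infty ⟨1, by
    rintro _ ⟨R, rfl⟩
    exact (R.isRepresentation.partialIsometry a).norm_le⟩⟩

/-- The C⋆-algebra `C⋆(E, 𝓛, 𝓔^{0,-})`: the universal C⋆-algebra generated by a
representation of the labelled space `(E, 𝓛, 𝓔^{0,-})`. -/
def cstarAlgebra :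
    NonUnitalStarSubalgebra ℂ (lp (fun R : E.Representation => R.carrier) ∞) :=
  generatedCStarAlgebra (fun R : E.Representation => R.carrier)
    (Set.range E.universalP ∪ Set.range E.universalS)

end LabelledGraph

/-! ### Symbolic matrix systems, λ-graph systems and their C⋆-algebras -/

/-- An essential symbolic matrix system over the alphabet `S`.  The rows and columns of the
matrices are indexed by finite types `V n`, where `n = 0, 1, 2, …`, and the entries of the symbolic
matrices `M n = M_{n,n+1}` are formal sums of symbols. -/
structure SymbolicMatrixSystem (S : Type u) where
  V : ℕ → Type u
  [fintype : ∀ n, Fintype (V n)]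
  /-- the symbolic matrices -/
  M : ∀ n, Matrix (V n) (V (n + 1)) (S →₀ ℕ)
  /-- the inclusion matrices -/
  I : ∀ n, Matrix (V n) (V (n + 1)) ℕ
  I_zero_one : ∀ n i j, I n i j = 0 ∨ I n i j = 1
  I_row : ∀ n i, ∃ j, I n i j ≠ 0
  I_col : ∀ n j, ∃! i, I n i j ≠ 0
  card_le : ∀ n, Fintype.card (V n) ≤ Fintype.card (V (n + 1))
  /-- `M_{n,n+1} I_{n+1,n+2} = I_{n,n+1} M_{n+1,n+2}` -/
  comm : ∀ n i j, ∑ k, I (n + 1) k j • M n i k = ∑ k, I n i k • M (n + 1) k j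
  M_row : ∀ n i, ∃ j, M n i j ≠ 0
  M_col : ∀ n j, ∃ i, M n i j ≠ 0

attribute [instance] SymbolicMatrixSystem.fintype

/-- A λ-graph system over the alphabet `S`: a labelled Bratteli diagram with finite vertex sets
`V n` and finite sets `Edge n` of labelled edges from `V n` to `V (n + 1)`, together with surjections
`ι : V (n + 1) → V n` satisfying the local property. -/
structure LambdaGraphSystem (S : Type u) where
  V : ℕ → Type u
  [fintype : ∀ n, Fintype (V n)]
  Edge : ℕ → Type u
  finite_edge : ∀ n, Finite (Edge n)
  src : ∀ {n}, Edge n → V n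
  tgt : ∀ {n}, Edge n → V (n + 1)
  label : ∀ {n}, Edge n → S
  ι : ∀ n, V (n + 1) → V n
  exists_src : ∀ n (v : V n), ∃ e : Edge n, src e = v
  exists_tgt : ∀ n (v : V (n + 1)), ∃ e : Edge n, tgt e = v
  ι_surjective : ∀ n, Function.Surjective (ι n)
  /-- For `i ∈ V n` and `j ∈ V (n + 2)` there is a label preserving bijection between the edges
  from `ι⁻¹(i)` to `j` and the edges from `i` to `ι(j)`. -/
  local_property : ∀ n (i : V n) (j : V (n + 2)),
    ∃ f : {e : Edge (n + 1) // ι n (src e) = i ∧ tgt e = j} ≃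
        {e : Edge n // src e = i ∧ tgt e = ι (n + 1) j},
      ∀ e, label (f e).1 = label e.1

attribute [instance] LambdaGraphSystem.fintype

namespace SymbolicMatrixSystem

variable {S : Type u} (𝓜 : SymbolicMatrixSystem S)

/-- For a vertex `j` in level `n + 1`, the unique `i` in level `n` with `I(i, j) = 1`. -/
def parent (n : ℕ) (j : 𝓜.V (n + 1)) : 𝓜.V n := (𝓜.I_col n j).choose

theorem parent_eq_iff (n : ℕ) (i : 𝓜.V n) (j : 𝓜.V (n + 1)) :
    𝓜.parent n j = i ↔ 𝓜.I n i j ≠ 0 := by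
  constructor
  · rintro rfl
    exact (𝓜.I_col n j).choose_spec.1
  · intro h
    exact ((𝓜.I_col n j).choose_spec.2 i h).symm

open Classical in
theorem I_eq (n : ℕ) (i : 𝓜.V n) (j : 𝓜.V (n + 1)) :
    𝓜.I n i j = if 𝓜.parent n j = i then 1 else 0 := by
  rw [parent_eq_iff]
  rcases 𝓜.I_zero_one n i j with h | h <;> simp [h]

/-- The edges from level `n` to level `n + 1`: as many edges from `i` to `j` with label `a` as the
symbol `a` occurs in the formal sum `M(i, j)`. -/
def LEdge (n : ℕ) : Type u :=
  Σ (i : 𝓜.V n) (j : 𝓜.V (n + 1)) (a : (𝓜.M n i j).support), Fin (𝓜.M n i j a)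

instance (n : ℕ) : Finite (𝓜.LEdge n) := by
  unfold LEdge
  infer_instance

/-- The edges from `i` to `j` labelled `a` are counted by the coefficient of `a` in `M(i, j)`. -/
def edgeEquiv (n : ℕ) (i : 𝓜.V n) (j : 𝓜.V (n + 1)) (a : S) :
    {e : 𝓜.LEdge n // e.1 = i ∧ e.2.1 = j ∧ e.2.2.1.1 = a} ≃ Fin (𝓜.M n i j a) where
  toFun := fun ⟨⟨i', j', a', k⟩, h⟩ => by
    dsimp only at h
    exact Fin.cast (by obtain ⟨rfl, rfl, rfl⟩ := h; rfl) k
  invFun k := ⟨⟨i, j, ⟨a, Finsupp.mem_support_iff.2 (fun h => by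
    rw [h] at k; exact k.elim0)⟩, k⟩, rfl, rfl, rfl⟩
  left_inv := by
    rintro ⟨⟨i', j', ⟨a', ha⟩, k⟩, rfl, rfl, rfl⟩
    rfl
  right_inv k := rfl

open Classical in
theorem comm_apply (n : ℕ) (i : 𝓜.V n) (j : 𝓜.V (n + 2)) (a : S) :
    𝓜.M n i (𝓜.parent (n + 1) j) a =
      ∑ k : {k : 𝓜.V (n + 1) // 𝓜.parent n k = i}, 𝓜.M (n + 1) k j a := by
  have h := DFunLike.congr_fun (𝓜.comm n i j) a
  simp only [Finsupp.finsetSum_apply, Finsupp.smul_apply, I_eq, smul_eq_mul, ite_mul, one_mul,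
    zero_mul, Finset.sum_ite_eq, Finset.mem_univ, if_true] at h
  rw [h, ← Finset.sum_filter]
  exact (Finset.sum_subtype _ (by simp) _)

/-- The λ-graph system of an essential symbolic matrix system. -/
def lambdaGraphSystem : LambdaGraphSystem S where
  V := 𝓜.V
  Edge := 𝓜.LEdge
  finite_edge := inferInstance
  src e := e.1
  tgt e := e.2.1
  label e := e.2.2.1
  ι := 𝓜.parent
  exists_src n v := by
    obtain ⟨j, hj⟩ := 𝓜.M_row n v
    obtain ⟨a, ha⟩ := Finsupp.support_nonempty_iff.2 hj
    exact ⟨⟨v, j, ⟨a, ha⟩, ⟨0, Nat.pos_of_ne_zero (Finsupp.mem_support_iff.1 ha)⟩⟩, rfl⟩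
  exists_tgt n v := by
    obtain ⟨i, hi⟩ := 𝓜.M_col n v
    obtain ⟨a, ha⟩ := Finsupp.support_nonempty_iff.2 hi
    exact ⟨⟨i, v, ⟨a, ha⟩, ⟨0, Nat.pos_of_ne_zero (Finsupp.mem_support_iff.1 ha)⟩⟩, rfl⟩
  ι_surjective n i := by
    obtain ⟨j, hj⟩ := 𝓜.I_row n i
    exact ⟨j, (𝓜.parent_eq_iff n i j).2 hj⟩
  local_property n i j := by
    classical
    let X := {e : 𝓜.LEdge (n + 1) // 𝓜.parent n e.1 = i ∧ e.2.1 = j}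
    let Y := {e : 𝓜.LEdge n // e.1 = i ∧ e.2.1 = 𝓜.parent (n + 1) j}
    let lX : X → S := fun e => e.1.2.2.1
    let lY : Y → S := fun e => e.1.2.2.1
    have key : ∀ a, Nonempty ({e : X // lX e = a} ≃ {e : Y // lY e = a}) := by
      intro a
      have eX : {e : X // lX e = a} ≃
          Σ k : {k : 𝓜.V (n + 1) // 𝓜.parent n k = i}, Fin (𝓜.M (n + 1) k j a) :=
        calc {e : X // lX e = a}
            ≃ Σ k : {k : 𝓜.V (n + 1) // 𝓜.parent n k = i},
                {e : 𝓜.LEdge (n + 1) // e.1 = k.1 ∧ e.2.1 = j ∧ e.2.2.1.1 = a} :=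
              { toFun := fun e => ⟨⟨e.1.1.1, e.1.2.1⟩, ⟨e.1.1, rfl, e.1.2.2, e.2⟩⟩
                invFun := fun q => ⟨⟨q.2.1, by rw [q.2.2.1]; exact q.1.2, q.2.2.2.1⟩, q.2.2.2.2⟩
                left_inv := fun _ => rfl
                right_inv := by rintro ⟨⟨_, hk⟩, ⟨e, h1, h⟩⟩; cases h1; rfl }
          _ ≃ _ := Equiv.sigmaCongrRight fun k => 𝓜.edgeEquiv (n + 1) k j a
      have eY : {e : Y // lY e = a} ≃ Fin (𝓜.M n i (𝓜.parent (n + 1) j) a) :=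
        calc {e : Y // lY e = a}
            ≃ {e : 𝓜.LEdge n // e.1 = i ∧ e.2.1 = 𝓜.parent (n + 1) j ∧ e.2.2.1.1 = a} :=
              { toFun := fun e => ⟨e.1.1, e.1.2.1, e.1.2.2, e.2⟩
                invFun := fun q => ⟨⟨q.1, q.2.1, q.2.2.1⟩, q.2.2.2⟩
                left_inv := fun _ => rfl
                right_inv := fun _ => rfl }
          _ ≃ _ := 𝓜.edgeEquiv n i _ a
      rw [𝓜.comm_apply] at eY
      exact ⟨eX.trans ((Fintype.equivOfCardEq (by simp)).trans eY.symm)⟩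
    have f := fun a => (key a).some
    refine ⟨(Equiv.sigmaFiberEquiv lX).symm.trans
      ((Equiv.sigmaCongrRight f).trans (Equiv.sigmaFiberEquiv lY)), fun e => ?_⟩
    exact (f (lX e) ⟨e, rfl⟩).2

end SymbolicMatrixSystem

namespace LambdaGraphSystem

variable {S : Type u} (𝔏 : LambdaGraphSystem S)

open Classical in
/-- `I(i, j) = 1` if `ι(j) = i`, and `0` otherwise. -/
def inclusion (n : ℕ) (i : 𝔏.V n) (j : 𝔏.V (n + 1)) : ℕ :=
  if 𝔏.ι n j = i then 1 else 0

open Classical in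
/-- `A(i, a, j) = 1` if there is an edge labelled `a` from `i` to `j`, and `0` otherwise. -/
def transition (n : ℕ) (i : 𝔏.V n) (a : S) (j : 𝔏.V (n + 1)) : ℕ :=
  if ∃ e : 𝔏.Edge n, 𝔏.src e = i ∧ 𝔏.tgt e = j ∧ 𝔏.label e = a then 1 else 0

/-- Partial isometries `t_a` and projections `F n i` in a unital C⋆-algebra satisfying the
relations of a λ-graph system over a finite alphabet. -/
structure IsRepresentation [Fintype S] {B : Type u} [CStarAlgebra B]
    (t : S → B) (F : ∀ n, 𝔏.V n → B) : Prop where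
  partialIsometry : ∀ a, IsPartialIsometry (t a)
  projection : ∀ n i, IsStarProjection (F n i)
  sum_range : ∑ a, t a * star (t a) = 1
  sum_proj : ∀ n, ∑ i, F n i = 1
  proj_eq : ∀ n i, F n i = ∑ j, 𝔏.inclusion n i j • F (n + 1) j
  commute : ∀ n a i, t a * star (t a) * F n i = F n i * (t a * star (t a))
  star_mul_mul : ∀ n a i,
    star (t a) * F n i * t a = ∑ j, 𝔏.transition n i a j • F (n + 1) j

/-- A unital C⋆-algebra together with a representation of the λ-graph system in it. -/
structure Representation [Fintype S] where
  carrier : Type u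
  [cstar : CStarAlgebra carrier]
  t : S → carrier
  F : ∀ n, 𝔏.V n → carrier
  isRepresentation : 𝔏.IsRepresentation t F

attribute [instance] Representation.cstar

variable [Fintype S]

/-- The generator `t_a` of the C⋆-algebra of a λ-graph system. -/
def universalT (a : S) : lp (fun R : 𝔏.Representation => R.carrier) ∞ :=
  ⟨fun R => R.t a, memℓp_infty ⟨1, by
    rintro _ ⟨R, rfl⟩
    exact (R.isRepresentation.partialIsometry a).norm_le⟩⟩

/-- The generator `E_i^n` of the C⋆-algebra of a λ-graph system. -/
def universalF (n : ℕ) (i : 𝔏.V n) : lp (fun R : 𝔏.Representation => R.carrier) ∞ :=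
  ⟨fun R => R.F n i, memℓp_infty ⟨1, by
    rintro _ ⟨R, rfl⟩
    exact (R.isRepresentation.projection n i).norm_le⟩⟩

/-- The C⋆-algebra `𝓞_𝔏` of a λ-graph system: the universal (unital) C⋆-algebra generated by
partial isometries and projections satisfying the relations above.  (The unit is in the generated
algebra, being the sum of the projections in any level.) -/
def cstarAlgebra :
    NonUnitalStarSubalgebra ℂ (lp (fun R : 𝔏.Representation => R.carrier) ∞) :=
  generatedCStarAlgebra (fun R : 𝔏.Representation => R.carrier)
    (Set.range 𝔏.universalT ∪ ⋃ n, Set.range (𝔏.universalF n))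

end LambdaGraphSystem

/-! ### The symbolic matrix system of a labelled graph -/

namespace LabelledGraph

variable {A : Type u} (E : LabelledGraph A)

/-- The set `Λ_ℓ(v)` of labelled paths of length at least `1` and at most `ℓ` arriving at `v`. -/
def received (l : ℕ) (v : E.V) : Set (List A) :=
  {α | α ∈ E.labelledPaths ∧ α.length ≤ l ∧ v ∈ E.range α}

/-- The equivalence relation `v ∼_ℓ w ↔ Λ_ℓ(v) = Λ_ℓ(w)`. -/
def recvSetoid (l : ℕ) : Setoid E.V := Setoid.ker (E.received l)

/-- The set `Ω_ℓ` of generalised vertices `[v]_ℓ`. -/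
def GenVertex (l : ℕ) : Type u := Quotient (E.recvSetoid l)

/-- The generalised vertex `[v]_ℓ`. -/
def genVertex (l : ℕ) (v : E.V) : E.GenVertex l := Quotient.mk (E.recvSetoid l) v

/-- A generalised vertex as a set of vertices. -/
def genVertexSet {l : ℕ} (p : E.GenVertex l) : Set E.V := {v | E.genVertex l v = p}

theorem genVertex_eq_iff {l : ℕ} {v w : E.V} :
    E.genVertex l v = E.genVertex l w ↔ E.received l v = E.received l w :=
  Quotient.eq (r := E.recvSetoid l)

theorem genVertex_surjective (l : ℕ) : Function.Surjective (E.genVertex l) :=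
  Quotient.mk_surjective

instance [Finite A] (l : ℕ) : Finite (E.GenVertex l) := by
  let T : Set (List A) := {α | α.length ≤ l}
  have hT : T.Finite := List.finite_length_le A l
  have := hT.powerset.to_subtype
  refine Finite.of_injective
    (fun p : E.GenVertex l => (⟨Quotient.lift (s := E.recvSetoid l) (E.received l)
      (fun _ _ h => h) p, ?_⟩ : T.powerset)) ?_
  · obtain ⟨v, rfl⟩ := E.genVertex_surjective l p
    exact fun α hα => hα.2.1
  · intro p q h
    obtain ⟨v, rfl⟩ := E.genVertex_surjective l p
    obtain ⟨w, rfl⟩ := E.genVertex_surjective l q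
    exact E.genVertex_eq_iff.2 (congrArg Subtype.val h)

theorem path_concat_iff {v w : E.V} {α : List A} {a : A} :
    E.Path v (α ++ [a]) w ↔ ∃ e, E.label e = a ∧ E.r e = w ∧ E.Path v α (E.s e) := by
  constructor
  · generalize hβ : α ++ [a] = β
    intro h
    induction h generalizing α with
    | nil v => simp at hβ
    | cons e h ih =>
      cases α with
      | nil =>
        simp only [List.nil_append, List.cons.injEq] at hβ
        obtain ⟨rfl, rfl⟩ := hβ
        have aux : ∀ {x y : E.V} {γ : List A}, E.Path x γ y → γ = [] → x = y := by
          intro x y γ h h'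
          cases h
          · rfl
          · simp at h'
        obtain rfl := aux h rfl
        exact ⟨e, rfl, rfl, Path.nil _⟩
      | cons b α =>
        simp only [List.cons_append, List.cons.injEq] at hβ
        obtain ⟨rfl, h2⟩ := hβ
        obtain ⟨f, hf1, hf2, hf3⟩ := ih h2
        exact ⟨f, hf1, hf2, Path.cons e hf3⟩
  · rintro ⟨e, rfl, rfl, h⟩
    have aux : ∀ {v x : E.V} {α : List A}, E.Path v α x → x = E.s e →
        E.Path v (α ++ [E.label e]) (E.r e) := by
      intro v x α h
      induction h with
      | nil v => rintro rfl; exact Path.cons e (Path.nil _)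
      | cons f h ih => intro hx; exact Path.cons f (ih hx)
    exact aux h rfl

theorem mem_received_iff {l : ℕ} {v : E.V} {α : List A} :
    α ∈ E.received l v ↔ α ≠ [] ∧ α.length ≤ l ∧ ∃ u, E.Path u α v :=
  ⟨fun h => ⟨h.1.1, h.2⟩, fun h => ⟨⟨h.1, h.2.2.imp fun _ hu => ⟨v, hu⟩⟩, h.2⟩⟩

theorem received_of_succ {l : ℕ} {v w : E.V} (h : E.received (l + 1) v = E.received (l + 1) w) :
    E.received l v = E.received l w := by
  ext α
  have := Set.ext_iff.1 h α
  simp only [mem_received_iff] at this ⊢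
  constructor
  · rintro ⟨h1, h2, h3⟩
    exact ⟨h1, h2, (this.1 ⟨h1, h2.trans (Nat.le_succ l), h3⟩).2.2⟩
  · rintro ⟨h1, h2, h3⟩
    exact ⟨h1, h2, (this.2 ⟨h1, h2.trans (Nat.le_succ l), h3⟩).2.2⟩

theorem exists_edge_of_received_eq (hE : E.LeftResolving) {l : ℕ} {w w' : E.V}
    (h : E.received (l + 1) w = E.received (l + 1) w') (e : E.Edge) (he : E.r e = w) :
    ∃ e', E.r e' = w' ∧ E.label e' = E.label e ∧ E.received l (E.s e') = E.received l (E.s e) := by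
  have h1 : [E.label e] ∈ E.received (l + 1) w :=
    E.mem_received_iff.2 ⟨by simp, by simp, E.s e, he ▸ Path.cons e (Path.nil _)⟩
  obtain ⟨-, -, u, hu⟩ := E.mem_received_iff.1 (h ▸ h1)
  obtain ⟨e', ha, hr, -⟩ := (E.path_concat_iff (α := [])).1 hu
  have aux : ∀ {x y : E.V} (f g : E.Edge), E.received (l + 1) x = E.received (l + 1) y →
      E.r f = x → E.r g = y → E.label f = E.label g →
      E.received l (E.s f) ⊆ E.received l (E.s g) := by
    intro x y f g hxy hf hg hfg α hα
    obtain ⟨hα1, hα2, u, hα3⟩ := E.mem_received_iff.1 hα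
    have h2 : α ++ [E.label f] ∈ E.received (l + 1) x :=
      E.mem_received_iff.2 ⟨by simp, by simpa using hα2, u,
        E.path_concat_iff.2 ⟨f, rfl, hf, hα3⟩⟩
    obtain ⟨-, -, u', hu'⟩ := E.mem_received_iff.1 (hxy ▸ h2)
    obtain ⟨g', hg1, hg2, hg3⟩ := E.path_concat_iff.1 hu'
    obtain rfl : g' = g := hE _ _ (hg2.trans hg.symm) (hg1.trans hfg)
    exact E.mem_received_iff.2 ⟨hα1, hα2, u', hg3⟩
  exact ⟨e', hr, ha, (aux e' e h.symm hr he ha).antisymm (aux e e' h he hr ha.symm)⟩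

/-- The number of edges with label `a` from the generalised vertex `p` to the vertex `w`. -/
def edgeCount {l : ℕ} (p : E.GenVertex l) (w : E.V) (a : A) : ℕ :=
  Nat.card {e : E.Edge // E.genVertex l (E.s e) = p ∧ E.r e = w ∧ E.label e = a}

open Classical in
theorem edgeCount_eq (hE : E.LeftResolving) {l : ℕ} (p : E.GenVertex l) (w : E.V) (a : A) :
    E.edgeCount p w a =
      if ∃ e, E.genVertex l (E.s e) = p ∧ E.r e = w ∧ E.label e = a then 1 else 0 := by
  unfold edgeCount
  have hs : Subsingleton
      {e : E.Edge // E.genVertex l (E.s e) = p ∧ E.r e = w ∧ E.label e = a} :=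
    ⟨fun e f => Subtype.ext (hE _ _ (e.2.2.1.trans f.2.2.1.symm) (e.2.2.2.trans f.2.2.2.symm))⟩
  split_ifs with h
  · obtain ⟨e, he⟩ := h
    have : Nonempty {e : E.Edge // E.genVertex l (E.s e) = p ∧ E.r e = w ∧ E.label e = a} :=
      ⟨⟨e, he⟩⟩
    exact Nat.card_unique
  · have : IsEmpty {e : E.Edge // E.genVertex l (E.s e) = p ∧ E.r e = w ∧ E.label e = a} :=
      ⟨fun e => h ⟨e.1, e.2⟩⟩
    exact Nat.card_of_isEmpty

/-- For a left-resolving labelled graph, the number of edges from `p ∈ Ω_ℓ` to `w` with a given label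
depends only on `[w]_{ℓ+1}`. -/
theorem edgeCount_congr (hE : E.LeftResolving) {l : ℕ} (p : E.GenVertex l) {w w' : E.V}
    (h : E.received (l + 1) w = E.received (l + 1) w') (a : A) :
    E.edgeCount p w a = E.edgeCount p w' a := by
  classical
  rw [edgeCount_eq E hE, edgeCount_eq E hE]
  have aux : ∀ {x y : E.V}, E.received (l + 1) x = E.received (l + 1) y →
      (∃ e, E.genVertex l (E.s e) = p ∧ E.r e = x ∧ E.label e = a) →
      ∃ e, E.genVertex l (E.s e) = p ∧ E.r e = y ∧ E.label e = a := by
    rintro x y hxy ⟨e, h1, h2, h3⟩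
    obtain ⟨e', h1', h2', h3'⟩ := E.exists_edge_of_received_eq hE hxy e h2
    exact ⟨e', (E.genVertex_eq_iff.2 h3').trans h1, h1', h2'.trans h3⟩
  exact if_congr ⟨aux h, aux h.symm⟩ rfl rfl

open Classical in
/-- The matrix `I(E)_{ℓ,ℓ+1}`: its entry at `([v]_ℓ, [w]_{ℓ+1})` is `1` if
`[w]_{ℓ+1} ⊆ [v]_ℓ` and `0` otherwise. -/
def inclusionMatrix (l : ℕ) : Matrix (E.GenVertex l) (E.GenVertex (l + 1)) ℕ := fun p q =>
  if E.genVertexSet q ⊆ E.genVertexSet p then 1 else 0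

open Classical in
theorem inclusionMatrix_eq (l : ℕ) (p : E.GenVertex l) (w : E.V) :
    E.inclusionMatrix l p (E.genVertex (l + 1) w) = if E.genVertex l w = p then 1 else 0 := by
  refine if_congr ⟨fun h => h (a := w) rfl, ?_⟩ rfl rfl
  rintro rfl v hv
  exact E.genVertex_eq_iff.2 (E.received_of_succ (E.genVertex_eq_iff.1 hv))

variable [Finite A]

/-- The symbolic matrix `M(E)_{ℓ,ℓ+1}`: its entry at `([v]_ℓ, [w]_{ℓ+1})` is the formal sum
`∑ 𝓛(e)` over the edges `e` with source in `[v]_ℓ` and range `w`. -/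
def symbolicMatrix (hE : E.LeftResolving) (l : ℕ) :
    Matrix (E.GenVertex l) (E.GenVertex (l + 1)) (A →₀ ℕ) := fun p q =>
  Quotient.lift (s := E.recvSetoid (l + 1))
    (fun w => Finsupp.equivFunOnFinite.symm (E.edgeCount p w))
    (fun _ _ h => congrArg _ (funext (E.edgeCount_congr hE p h))) q

theorem symbolicMatrix_apply (hE : E.LeftResolving) (l : ℕ) (p : E.GenVertex l) (w : E.V) (a : A) :
    E.symbolicMatrix hE l p (E.genVertex (l + 1) w) a = E.edgeCount p w a := rfl

/-- The essential symbolic matrix system `(M(E)_{ℓ,ℓ+1}, I(E)_{ℓ,ℓ+1})_{ℓ ≥ 1}` of an essential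
left-resolving labelled graph over a finite alphabet.  Its level `n = 0, 1, 2, …` is `ℓ = n + 1`. -/
def symbolicMatrixSystem (hess : E.Essential) (hE : E.LeftResolving) : SymbolicMatrixSystem A where
  V n := E.GenVertex (n + 1)
  fintype n := Fintype.ofFinite _
  M n := E.symbolicMatrix hE (n + 1)
  I n := E.inclusionMatrix (n + 1)
  I_zero_one n i j := by
    unfold inclusionMatrix
    split_ifs <;> simp
  I_row n i := by
    obtain ⟨v, rfl⟩ := E.genVertex_surjective _ i
    exact ⟨E.genVertex _ v, by simp [inclusionMatrix_eq]⟩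
  I_col n j := by
    obtain ⟨v, rfl⟩ := E.genVertex_surjective _ j
    refine ⟨E.genVertex _ v, by simp [inclusionMatrix_eq], fun p hp => ?_⟩
    by_contra h
    exact hp ((E.inclusionMatrix_eq _ p v).trans (if_neg (Ne.symm h)))
  card_le n := by
    refine @Fintype.card_le_of_surjective _ _ (_) (_)
      (Quotient.map' (s₁ := E.recvSetoid (n + 2)) (s₂ := E.recvSetoid (n + 1)) id
        (fun _ _ h => E.received_of_succ h)) fun p => ?_
    obtain ⟨v, rfl⟩ := E.genVertex_surjective _ p
    exact ⟨E.genVertex _ v, rfl⟩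
  comm n i j := by
    classical
    obtain ⟨w, rfl⟩ := E.genVertex_surjective _ j
    ext a
    simp only [Finsupp.finsetSum_apply, Finsupp.smul_apply, inclusionMatrix_eq, smul_eq_mul,
      ite_mul, one_mul, zero_mul, Finset.sum_ite_eq, Finset.mem_univ, if_true,
      symbolicMatrix_apply]
    by_cases h : ∃ e, E.r e = w ∧ E.label e = a
    · obtain ⟨e, rfl, rfl⟩ := h
      have key : ∀ (l : ℕ) (p : E.GenVertex l),
          E.edgeCount p (E.r e) (E.label e) = if E.genVertex l (E.s e) = p then 1 else 0 := by
        intro l p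
        rw [edgeCount_eq E hE]
        refine if_congr ⟨?_, fun h => ⟨e, h, rfl, rfl⟩⟩ rfl rfl
        rintro ⟨f, h1, h2, h3⟩
        rwa [hE f e h2 h3] at h1
      simp only [key, mul_ite, mul_one, mul_zero, Finset.sum_ite_eq, Finset.mem_univ, if_true]
      rw [inclusionMatrix_eq]
    · have key : ∀ (l : ℕ) (p : E.GenVertex l), E.edgeCount p w a = 0 := by
        intro l p
        rw [edgeCount_eq E hE, if_neg]
        rintro ⟨f, -, h2, h3⟩
        exact h ⟨f, h2, h3⟩
      simp [key]
  M_row n i := by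
    obtain ⟨v, rfl⟩ := E.genVertex_surjective _ i
    obtain ⟨e, rfl⟩ := (hess v).1
    refine ⟨E.genVertex _ (E.r e), fun h => ?_⟩
    have h1 := DFunLike.congr_fun h (E.label e)
    rw [symbolicMatrix_apply, edgeCount_eq E hE, if_pos ⟨e, rfl, rfl, rfl⟩] at h1
    exact one_ne_zero h1
  M_col n j := by
    obtain ⟨v, rfl⟩ := E.genVertex_surjective _ j
    obtain ⟨e, rfl⟩ := (hess v).2
    refine ⟨E.genVertex _ (E.s e), fun h => ?_⟩
    have h1 := DFunLike.congr_fun h (E.label e)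
    rw [symbolicMatrix_apply, edgeCount_eq E hE, if_pos ⟨e, rfl, rfl, rfl⟩] at h1
    exact one_ne_zero h1

end LabelledGraph

end

noncomputable section

/-! ### Star homomorphisms between `ℓ^∞`-products and generated subalgebras -/

/-! Both algebras are built from the same commutative algebra, the functions on `E⁰` that are
constant on the classes of `∼_ℓ` for some `ℓ`, together with the same partial isometries `s_a =
t_a`. One spanning set consists of the indicators of the sets `X` indexing the `p_X`, the other of
the indicators of the generalised vertices.

The two spans agree. Since the graph is left-resolving, every `X` is a union of classes at some
level (`exists_saturated`). Conversely, a class is cut out by finitely many conditions `w ∈ r(α)` or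
`w ∉ r(α)`, so its indicator is a linear combination of indicators of sets in the collection
(`indicator_genVertexSet_mem_range_simpleFunction`). The collection need not contain complements, so
linear combinations are really needed, and `1_X ↦ p_X` must be known to extend linearly: every
linear relation between the indicators holds between the projections (`linear_relation_aux`,
`linearCombination_congr`). On the other side, `levelSum` sends a level function to an element that
does not depend on the level (`levelSum_of_le`).

Compression by a symbol, `x ↦ s_a⋆ x s_a`, acts on functions in both algebras as pull-back along the
edges labelled `a` (`transfer`). Hence the defining relations on either side become identities
between functions, and each kind of representation yields one of the other kind
(`isRepresentation_lambdaGraph`, `isRepresentation_levelProjection`). As `E⁰` is the finite union of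
the `r(a)`, the projection `p_{E⁰}` acts as a unit on all the generators, and the unital
representation is taken in the corner which it defines.

Each universal algebra sits in the product over all its representations. The two constructions on
representations therefore induce star homomorphisms between these products, and these are mutually
inverse on generators. -/

/-- The star homomorphism of `ℓ^∞`-products induced by a map of the index sets and star
homomorphisms of the factors. -/
def lpInftyMap {ι ι' : Type v} {B : ι → Type u} {B' : ι' → Type u}
    [∀ i, NonUnitalCStarAlgebra (B i)] [∀ i, NonUnitalCStarAlgebra (B' i)]
    (σ : ι' → ι) (φ : ∀ j, B (σ j) →⋆ₙₐ[ℂ] B' j) : lp B ∞ →⋆ₙₐ[ℂ] lp B' ∞ where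
  toFun f := ⟨fun j => φ j (f (σ j)), memℓp_infty ⟨‖f‖, by
    rintro _ ⟨j, rfl⟩
    exact (NonUnitalStarAlgHom.norm_apply_le (φ j) _).trans
      (lp.norm_apply_le_norm ENNReal.top_ne_zero f _)⟩⟩
  map_smul' c f := by ext j; exact map_smul (φ j) c _
  map_zero' := by ext j; exact map_zero (φ j)
  map_add' f g := by ext j; exact map_add (φ j) _ _
  map_mul' f g := by ext j; exact map_mul (φ j) _ _
  map_star' f := by ext j; exact map_star (φ j) _

theorem NonUnitalStarAlgHom.continuous_of_cstar {X Y : Type*} [NonUnitalCStarAlgebra X]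
    [NonUnitalCStarAlgebra Y] (φ : X →⋆ₙₐ[ℂ] Y) : Continuous φ :=
  AddMonoidHomClass.continuous_of_bound φ 1 fun x => by
    simpa using NonUnitalStarAlgHom.norm_apply_le φ x

open NonUnitalStarAlgebra in
/-- A star homomorphism maps the closed star subalgebra generated by a set into every closed star
subalgebra which contains the image of that set. -/
theorem map_mem_of_mem_topologicalClosure_adjoin {X Y : Type*} [NonUnitalCStarAlgebra X]
    [NonUnitalCStarAlgebra Y] (φ : X →⋆ₙₐ[ℂ] Y) {g : Set X} {T : NonUnitalStarSubalgebra ℂ Y}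
    (hT : IsClosed (T : Set Y)) (hg : ∀ x ∈ g, φ x ∈ T) {x : X}
    (hx : x ∈ (adjoin ℂ g).topologicalClosure) : φ x ∈ T := by
  have h : (adjoin ℂ g).topologicalClosure ≤ T.comap φ :=
    NonUnitalStarSubalgebra.topologicalClosure_minimal _ (adjoin_le hg)
      (hT.preimage φ.continuous_of_cstar)
  exact h hx

open NonUnitalStarAlgebra in
/-- Two star homomorphisms which agree on a set agree on the closed star subalgebra it generates. -/
theorem eqOn_topologicalClosure_adjoin {X Y : Type*} [NonUnitalCStarAlgebra X]
    [NonUnitalCStarAlgebra Y] (φ ψ : X →⋆ₙₐ[ℂ] Y) {g : Set X} (hg : ∀ x ∈ g, φ x = ψ x) {x : X}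
    (hx : x ∈ (adjoin ℂ g).topologicalClosure) : φ x = ψ x := by
  have h : (adjoin ℂ g).topologicalClosure ≤ NonUnitalStarAlgHom.equalizer φ ψ :=
    NonUnitalStarSubalgebra.topologicalClosure_minimal _ (adjoin_le hg)
      (isClosed_eq φ.continuous_of_cstar ψ.continuous_of_cstar)
  exact h hx

open NonUnitalStarAlgebra in
/-- Star homomorphisms which are inverse to each other on sets of generators give an isomorphism of
the generated C⋆-algebras. -/
theorem nonempty_starAlgEquiv_of_generators {X Y : Type*} [NonUnitalCStarAlgebra X]
    [NonUnitalCStarAlgebra Y] (φ : X →⋆ₙₐ[ℂ] Y) (ψ : Y →⋆ₙₐ[ℂ] X) {g : Set X} {h : Set Y}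
    (hφ : ∀ x ∈ g, φ x ∈ (adjoin ℂ h).topologicalClosure)
    (hψ : ∀ y ∈ h, ψ y ∈ (adjoin ℂ g).topologicalClosure)
    (hψφ : ∀ x ∈ g, ψ (φ x) = x) (hφψ : ∀ y ∈ h, φ (ψ y) = y) :
    Nonempty ((adjoin ℂ g).topologicalClosure ≃⋆ₐ[ℂ] (adjoin ℂ h).topologicalClosure) :=
  ⟨{ toFun := fun x => ⟨φ x, map_mem_of_mem_topologicalClosure_adjoin φ
        (NonUnitalStarSubalgebra.isClosed_topologicalClosure _) hφ x.2⟩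
     invFun := fun y => ⟨ψ y, map_mem_of_mem_topologicalClosure_adjoin ψ
        (NonUnitalStarSubalgebra.isClosed_topologicalClosure _) hψ y.2⟩
     left_inv := fun x => Subtype.ext
        (eqOn_topologicalClosure_adjoin (ψ.comp φ) (NonUnitalStarAlgHom.id ℂ X) hψφ x.2)
     right_inv := fun y => Subtype.ext
        (eqOn_topologicalClosure_adjoin (φ.comp ψ) (NonUnitalStarAlgHom.id ℂ Y) hφψ y.2)
     map_mul' := fun _ _ => Subtype.ext (map_mul φ _ _)
     map_add' := fun _ _ => Subtype.ext (map_add φ _ _)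
     map_star' := fun _ => Subtype.ext (map_star φ _)
     map_smul' := fun c _ => Subtype.ext (map_smul φ c _) }⟩

/-! ### Corners -/

/-- The corner `pBp` of a projection. -/
def cornerSubalgebra {B : Type u} [NonUnitalCStarAlgebra B] {p : B} (hp : IsStarProjection p) :
    NonUnitalStarSubalgebra ℂ B where
  carrier := {x | p * x = x ∧ x * p = x}
  zero_mem' := by simp
  add_mem' hx hy := by simp [mul_add, add_mul, hx.1, hx.2, hy.1, hy.2]
  mul_mem' {x y} hx hy :=
    ⟨by rw [← mul_assoc, hx.1], by rw [mul_assoc, hy.2]⟩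
  smul_mem' c x hx := by simp [mul_smul_comm, smul_mul_assoc, hx.1, hx.2]
  star_mem' {x} hx := by
    have h := hp.isSelfAdjoint.star_eq
    constructor
    · calc p * star x = star (x * p) := by rw [star_mul, h]
        _ = star x := by rw [hx.2]
    · calc star x * p = star (p * x) := by rw [star_mul, h]
        _ = star x := by rw [hx.1]

theorem isClosed_cornerSubalgebra {B : Type u} [NonUnitalCStarAlgebra B] {p : B}
    (hp : IsStarProjection p) : IsClosed (cornerSubalgebra hp : Set B) :=
  (isClosed_eq (continuous_const.mul continuous_id) continuous_id).inter
    (isClosed_eq (continuous_id.mul continuous_const) continuous_id)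

/-- The unit of the corner is `p` itself. This makes the corner a unital C⋆-algebra even if `B` has
no unit, as the relations of a λ-graph system require. -/
instance {B : Type u} [NonUnitalCStarAlgebra B] {p : B} (hp : IsStarProjection p) :
    One (cornerSubalgebra hp) := ⟨⟨p, hp.isIdempotentElem, hp.isIdempotentElem⟩⟩

instance {B : Type u} [NonUnitalCStarAlgebra B] {p : B} (hp : IsStarProjection p) :
    Ring (cornerSubalgebra hp) :=
  { (inferInstance : NonUnitalRing (cornerSubalgebra hp)),
    (inferInstance : One (cornerSubalgebra hp)) with
    one_mul := fun x => Subtype.ext x.2.1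
    mul_one := fun x => Subtype.ext x.2.2 }

instance {B : Type u} [NonUnitalCStarAlgebra B] {p : B} (hp : IsStarProjection p) :
    NormedRing (cornerSubalgebra hp) :=
  { (inferInstance : NonUnitalNormedRing (cornerSubalgebra hp)),
    (inferInstance : Ring (cornerSubalgebra hp)) with }

instance {B : Type u} [NonUnitalCStarAlgebra B] {p : B} (hp : IsStarProjection p) :
    NormedAlgebra ℂ (cornerSubalgebra hp) :=
  { Algebra.ofModule (fun c x y => smul_mul_assoc c x y) (fun c x y => mul_smul_comm c x y) with
    norm_smul_le := fun c x => norm_smul_le c (x : B) }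

instance {B : Type u} [NonUnitalCStarAlgebra B] {p : B} (hp : IsStarProjection p) :
    CStarAlgebra (cornerSubalgebra hp) :=
  { (inferInstance : NormedRing (cornerSubalgebra hp)),
    (inferInstance : StarRing (cornerSubalgebra hp)),
    (inferInstance : NormedAlgebra ℂ (cornerSubalgebra hp)),
    (inferInstance : StarModule ℂ (cornerSubalgebra hp)) with
    complete := by
      have : CompleteSpace (cornerSubalgebra hp) :=
        (isClosed_cornerSubalgebra hp).completeSpace_coe
      intro f hf
      exact CompleteSpace.complete hf
    norm_mul_self_le := fun x => CStarRing.norm_mul_self_le (x : B) }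

/-- The inclusion of a corner. -/
def cornerSubtype {B : Type u} [NonUnitalCStarAlgebra B] {p : B} (hp : IsStarProjection p) :
    cornerSubalgebra hp →⋆ₙₐ[ℂ] B where
  toFun := Subtype.val
  map_smul' _ _ := rfl
  map_zero' := rfl
  map_add' _ _ := rfl
  map_mul' _ _ := rfl
  map_star' _ := rfl

/-! ### Projections with sum one -/

open scoped ComplexOrder CStarAlgebra in
/-- Partial isometries whose range projections have sum one have orthogonal ranges. -/
theorem star_mul_eq_zero_of_sum_eq_one {B : Type u} [CStarAlgebra B] {ι : Type*} [Fintype ι]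
    {x : ι → B} (hx : ∀ i, IsPartialIsometry (x i)) (hsum : ∑ i, x i * star (x i) = 1)
    {i j : ι} (hij : i ≠ j) : star (x i) * x j = 0 := by
  classical
  let _ : PartialOrder B := CStarAlgebra.spectralOrder B
  have : StarOrderedRing B := CStarAlgebra.spectralOrderedRing B
  have hj : x j * star (x j) * x j = x j := hx j
  -- Compress the identity `∑ x_k x_k⋆ = 1` by `x_j`. The term `k = j` alone already gives `x_j⋆
  -- x_j`, so the other terms, which are positive, sum to zero.
  have h1 : ∑ k, star (x j) * (x k * star (x k)) * x j = star (x j) * x j := by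
    rw [← Finset.sum_mul, ← Finset.mul_sum, hsum, mul_one]
  have h2 : ∑ k ∈ Finset.univ.erase j, star (x j) * (x k * star (x k)) * x j = 0 := by
    have := Finset.add_sum_erase Finset.univ
      (fun k => star (x j) * (x k * star (x k)) * x j) (Finset.mem_univ j)
    rw [h1, mul_assoc, hj] at this
    simpa using this
  have h3 : ∀ k, star (x j) * (x k * star (x k)) * x j =
      star (star (x k) * x j) * (star (x k) * x j) := by
    intro k
    simp [mul_assoc]
  have h4 := (Finset.sum_eq_zero_iff_of_nonneg (fun k _ => by
    rw [h3]; exact star_mul_self_nonneg _)).1 h2 i (Finset.mem_erase.2 ⟨hij, Finset.mem_univ i⟩)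
  rw [h3] at h4
  exact CStarRing.star_mul_self_eq_zero_iff _ |>.1 h4

theorem IsStarProjection.isPartialIsometry {B : Type u} [Semigroup B] [Star B] {p : B}
    (hp : IsStarProjection p) : IsPartialIsometry p := by
  change p * star p * p = p
  rw [hp.isSelfAdjoint.star_eq, hp.isIdempotentElem.eq, hp.isIdempotentElem.eq]

/-- Projections with sum one are orthogonal. -/
theorem mul_eq_zero_of_sum_eq_one {B : Type u} [CStarAlgebra B] {ι : Type*} [Fintype ι]
    {p : ι → B} (hp : ∀ i, IsStarProjection (p i)) (hsum : ∑ i, p i = 1) {i j : ι} (hij : i ≠ j) :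
    p i * p j = 0 := by
  have h := star_mul_eq_zero_of_sum_eq_one (x := p) (fun i => (hp i).isPartialIsometry)
    (by rw [← hsum]; exact Finset.sum_congr rfl fun i _ => by
          rw [(hp i).isSelfAdjoint.star_eq, (hp i).isIdempotentElem.eq]) hij
  rwa [(hp i).isSelfAdjoint.star_eq] at h

namespace LabelledGraph

variable {A : Type u} (E : LabelledGraph A)

/-! ### Relative ranges -/

theorem path_nil_iff {v w : E.V} : E.Path v [] w ↔ v = w :=
  ⟨fun h => by cases h; rfl, fun h => h ▸ Path.nil v⟩

theorem relRange_nil (X : Set E.V) : E.relRange X [] = X := by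
  ext w
  simp [relRange, path_nil_iff]

theorem mem_relRange_concat {X : Set E.V} {α : List A} {a : A} {w : E.V} :
    w ∈ E.relRange X (α ++ [a]) ↔ ∃ e, E.s e ∈ E.relRange X α ∧ E.r e = w ∧ E.label e = a := by
  simp only [relRange, Set.mem_ofPred_eq, path_concat_iff]
  constructor
  · rintro ⟨v, hv, e, h1, h2, h3⟩
    exact ⟨e, ⟨v, hv, h3⟩, h2, h1⟩
  · rintro ⟨e, ⟨v, hv, h3⟩, h2, h1⟩
    exact ⟨v, hv, e, h1, h2, h3⟩

theorem mem_relRange_singleton {X : Set E.V} {a : A} {w : E.V} :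
    w ∈ E.relRange X [a] ↔ ∃ e, E.s e ∈ X ∧ E.r e = w ∧ E.label e = a := by
  have h := E.mem_relRange_concat (X := X) (α := []) (a := a) (w := w)
  rwa [relRange_nil, List.nil_append] at h

theorem range_eq_relRange_univ (α : List A) : E.range α = E.relRange Set.univ α := by
  simp [range, relRange]

theorem relRange_eq_empty {X : Set E.V} {α : List A} (h0 : α ≠ []) (h : α ∉ E.labelledPaths) :
    E.relRange X α = ∅ := by
  refine Set.eq_empty_of_forall_notMem fun w hw => h ⟨h0, ?_⟩
  obtain ⟨v, -, hv⟩ := hw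
  exact ⟨v, w, hv⟩

/-! ### Membership in the smallest accommodating collection -/

theorem isAccommodating_smallestAccommodating : E.IsAccommodating E.smallestAccommodating where
  relRange_mem X hX α hα 𝓑 h𝓑 := h𝓑.relRange_mem X (hX 𝓑 h𝓑) α hα
  range_mem α hα _ h𝓑 := h𝓑.range_mem α hα
  inter_mem X hX Y hY 𝓑 h𝓑 := h𝓑.inter_mem X (hX 𝓑 h𝓑) Y (hY 𝓑 h𝓑)
  union_mem X hX Y hY 𝓑 h𝓑 := h𝓑.union_mem X (hX 𝓑 h𝓑) Y (hY 𝓑 h𝓑)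

theorem empty_mem_projectionSets : ∅ ∈ E.projectionSets := Set.mem_insert _ _

theorem inter_mem_projectionSets {X Y : Set E.V} (hX : X ∈ E.projectionSets)
    (hY : Y ∈ E.projectionSets) : X ∩ Y ∈ E.projectionSets := by
  rcases hX with rfl | hX
  · simpa using E.empty_mem_projectionSets
  rcases hY with rfl | hY
  · simpa using E.empty_mem_projectionSets
  exact Or.inr (E.isAccommodating_smallestAccommodating.inter_mem X hX Y hY)

theorem union_mem_projectionSets {X Y : Set E.V} (hX : X ∈ E.projectionSets)
    (hY : Y ∈ E.projectionSets) : X ∪ Y ∈ E.projectionSets := by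
  rcases hX with rfl | hX
  · simpa using hY
  rcases hY with rfl | hY
  · rw [Set.union_empty]
    exact Or.inr hX
  exact Or.inr (E.isAccommodating_smallestAccommodating.union_mem X hX Y hY)

/-- A nonempty word that labels no path has empty range, and `∅` was added to the collection. So no
word has to be checked to lie in `𝓛*(E)`. -/
theorem range_mem_projectionSets {α : List A} (h0 : α ≠ []) : E.range α ∈ E.projectionSets := by
  by_cases h : α ∈ E.labelledPaths
  · exact Or.inr (E.isAccommodating_smallestAccommodating.range_mem α h)
  · rw [range_eq_relRange_univ, relRange_eq_empty E h0 h]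
    exact E.empty_mem_projectionSets

theorem relRange_mem_projectionSets {X : Set E.V} (hX : X ∈ E.projectionSets) {α : List A}
    (h0 : α ≠ []) : E.relRange X α ∈ E.projectionSets := by
  by_cases h : α ∈ E.labelledPaths
  · rcases hX with rfl | hX
    · simpa [relRange] using E.empty_mem_projectionSets
    · exact Or.inr (E.isAccommodating_smallestAccommodating.relRange_mem X hX α h)
  · rw [relRange_eq_empty E h0 h]
    exact E.empty_mem_projectionSets

/-- Every vertex receives an edge, so `E⁰` is the union of the finitely many sets `r(a)`. This
supplies the unit `p_{E⁰}`. -/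
theorem univ_mem_projectionSets [Finite A] (hess : E.Essential) :
    Set.univ ∈ E.projectionSets := by
  have key : ∀ s : Set A, s.Finite → (⋃ a ∈ s, E.range [a]) ∈ E.projectionSets := by
    intro s hs
    induction s, hs using Set.Finite.induction_on with
    | empty => simpa using E.empty_mem_projectionSets
    | insert _ _ ih =>
      rw [Set.biUnion_insert]
      exact E.union_mem_projectionSets (E.range_mem_projectionSets (by simp)) ih
  have h : (⋃ a ∈ (Set.univ : Set A), E.range [a]) = Set.univ := by
    refine Set.eq_univ_of_forall fun v => ?_
    obtain ⟨e, rfl⟩ := (hess v).2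
    exact Set.mem_biUnion (Set.mem_univ (E.label e)) ⟨E.s e, Path.cons e (Path.nil _)⟩
  exact h ▸ key _ Set.finite_univ

/-! ### Sets saturated for the equivalence relation at some level -/

/-- `X` is a union of generalised vertices of level `l`. -/
def Saturated (l : ℕ) (X : Set E.V) : Prop :=
  ∀ v w, E.received l v = E.received l w → v ∈ X → w ∈ X

variable {E}

theorem received_of_le {l m : ℕ} (hlm : l ≤ m) {v w : E.V}
    (h : E.received m v = E.received m w) : E.received l v = E.received l w := by
  induction m, hlm using Nat.le_induction with
  | base => exact h
  | succ m _ ih => exact ih (E.received_of_succ h)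

theorem Saturated.mono {l m : ℕ} (hlm : l ≤ m) {X : Set E.V} (h : E.Saturated l X) :
    E.Saturated m X := fun v w hvw => h v w (received_of_le hlm hvw)

theorem Saturated.inter {l : ℕ} {X Y : Set E.V} (hX : E.Saturated l X) (hY : E.Saturated l Y) :
    E.Saturated l (X ∩ Y) := fun v w hvw h => ⟨hX v w hvw h.1, hY v w hvw h.2⟩

theorem Saturated.union {l : ℕ} {X Y : Set E.V} (hX : E.Saturated l X) (hY : E.Saturated l Y) :
    E.Saturated l (X ∪ Y) := fun v w hvw h => h.imp (hX v w hvw) (hY v w hvw)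

/-- If two vertices are equivalent at level `l + 1`, an `a`-edge into one is matched by an `a`-edge
into the other with `l`-equivalent source (`exists_edge_of_received_eq`). Each letter thus costs one
level. The induction removes the last letter because the equivalence looks backwards from the range.
-/
theorem Saturated.relRange (hE : E.LeftResolving) {l : ℕ} {X : Set E.V} (hX : E.Saturated l X)
    (α : List A) : E.Saturated (l + α.length) (E.relRange X α) := by
  induction α using List.reverseRecOn with
  | nil => simpa [relRange_nil] using hX
  | append_singleton α a ih =>
    intro v w hvw hv
    rw [mem_relRange_concat] at hv ⊢
    obtain ⟨e, h1, h2, h3⟩ := hv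
    rw [List.length_append, List.length_singleton, ← add_assoc] at hvw
    obtain ⟨e', h1', h2', h3'⟩ := E.exists_edge_of_received_eq hE hvw e h2
    exact ⟨e', ih _ _ h3'.symm h1, h1', h2'.trans h3⟩

/-- The sets that are saturated at some level form an accommodating collection, hence contain the
smallest one. For `r(α)`, start from `E⁰`, which is saturated at level `0`. -/
theorem exists_saturated (hE : E.LeftResolving) {X : Set E.V} (hX : X ∈ E.projectionSets) :
    ∃ l, E.Saturated l X := by
  rcases hX with rfl | hX
  · exact ⟨0, fun _ _ _ h => h⟩
  refine hX {X | ∃ l, E.Saturated l X} ⟨?_, ?_, ?_, ?_⟩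
  · rintro X ⟨l, hX⟩ α -
    exact ⟨_, hX.relRange hE α⟩
  · intro α _
    rw [Set.mem_ofPred_eq, range_eq_relRange_univ]
    exact ⟨_, Saturated.relRange (l := 0) hE (fun _ _ _ _ => Set.mem_univ _) α⟩
  · rintro X ⟨l, hX⟩ Y ⟨m, hY⟩
    exact ⟨_, (hX.mono (le_max_left l m)).inter (hY.mono (le_max_right l m))⟩
  · rintro X ⟨l, hX⟩ Y ⟨m, hY⟩
    exact ⟨_, (hX.mono (le_max_left l m)).union (hY.mono (le_max_right l m))⟩

variable (E)

/-! ### The transfer operator of a symbol -/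

open Classical in
/-- The operator on functions on the vertices with `(transfer a f) (r e) = f (s e)` for all edges
`e` labelled `a`, which vanishes at vertices without an incoming edge labelled `a`. -/
def transfer (a : A) : (E.V → ℂ) →ₗ[ℂ] (E.V → ℂ) where
  toFun f w := if h : ∃ e, E.r e = w ∧ E.label e = a then f (E.s h.choose) else 0
  map_add' f g := by
    ext w
    simp only [Pi.add_apply]
    split_ifs <;> simp
  map_smul' c f := by
    ext w
    simp only [Pi.smul_apply, smul_eq_mul, RingHom.id_apply]
    split_ifs <;> simp

open Classical in
theorem transfer_apply_range (hE : E.LeftResolving) (f : E.V → ℂ) (e : E.Edge) :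
    E.transfer (E.label e) f (E.r e) = f (E.s e) := by
  have h : ∃ e', E.r e' = E.r e ∧ E.label e' = E.label e := ⟨e, rfl, rfl⟩
  change (if h : ∃ e', E.r e' = E.r e ∧ E.label e' = E.label e then f (E.s h.choose) else 0) = _
  rw [dif_pos h, hE _ _ h.choose_spec.1 h.choose_spec.2]

/-- The default value `0` is the right one: it matches `s_a⋆ x s_a` living under `s_a⋆ s_a =
p_{r(a)}`. -/
theorem transfer_apply_eq_zero {a : A} (f : E.V → ℂ) {w : E.V}
    (h : ¬∃ e, E.r e = w ∧ E.label e = a) : E.transfer a f w = 0 := dif_neg h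

theorem transfer_indicator (hE : E.LeftResolving) (a : A) (X : Set E.V) :
    E.transfer a (X.indicator 1) = (E.relRange X [a]).indicator 1 := by
  classical
  ext w
  by_cases h : ∃ e, E.r e = w ∧ E.label e = a
  · obtain ⟨e, rfl, rfl⟩ := h
    rw [transfer_apply_range E hE, Set.indicator_apply, Set.indicator_apply]
    refine if_congr ?_ rfl rfl
    rw [mem_relRange_singleton]
    refine ⟨fun h => ⟨e, h, rfl, rfl⟩, ?_⟩
    rintro ⟨f, h1, h2, h3⟩
    rwa [hE f e h2 h3] at h1
  · rw [transfer_apply_eq_zero E _ h, Set.indicator_of_notMem]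
    rw [mem_relRange_singleton]
    rintro ⟨e, -, h2, h3⟩
    exact h ⟨e, h2, h3⟩

/-! ### Linear combinations of indicator functions -/

/-- The linear combination of the indicator functions of the sets in `𝓔^{0,-} ∪ {∅}` with given
coefficients. -/
def simpleFunction : (E.projectionSets →₀ ℂ) →ₗ[ℂ] (E.V → ℂ) :=
  Finsupp.linearCombination ℂ fun X => X.1.indicator 1

theorem simpleFunction_single (X : E.projectionSets) (k : ℂ) :
    E.simpleFunction (Finsupp.single X k) = k • X.1.indicator 1 :=
  Finsupp.linearCombination_single ..

theorem indicator_mem_range_simpleFunction {X : Set E.V} (hX : X ∈ E.projectionSets) :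
    X.indicator 1 ∈ LinearMap.range E.simpleFunction :=
  ⟨Finsupp.single ⟨X, hX⟩ 1, by rw [simpleFunction_single, one_smul]⟩

theorem mul_mem_range_simpleFunction {f g : E.V → ℂ} (hf : f ∈ LinearMap.range E.simpleFunction)
    (hg : g ∈ LinearMap.range E.simpleFunction) : f * g ∈ LinearMap.range E.simpleFunction := by
  have h := Submodule.mul_mem_mul hf hg
  rw [simpleFunction, Finsupp.range_linearCombination, Submodule.span_mul_span] at h
  rw [simpleFunction, Finsupp.range_linearCombination]
  refine Submodule.span_mono ?_ h
  rintro _ ⟨_, ⟨X, rfl⟩, _, ⟨Y, rfl⟩, rfl⟩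
  refine ⟨⟨X.1 ∩ Y.1, E.inter_mem_projectionSets X.2 Y.2⟩, ?_⟩
  exact Set.inter_indicator_one

/-- A class `[v]_l` is the intersection, over the finitely many nonempty words `α` of length at most
`l`, of `r(α)` or its complement, according to whether `v` receives `α`. The span is closed under
products and contains `1`, so it contains the indicator of this intersection. -/
theorem indicator_genVertexSet_mem_range_simpleFunction [Finite A] (hess : E.Essential) {l : ℕ}
    (P : E.GenVertex l) :
    (E.genVertexSet P).indicator 1 ∈ LinearMap.range E.simpleFunction := by
  classical
  obtain ⟨v, rfl⟩ := E.genVertex_surjective l P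
  have key : ∀ s : Set (List A), s.Finite → (∀ α ∈ s, α ≠ []) →
      {w | ∀ α ∈ s, w ∈ E.range α ↔ v ∈ E.range α}.indicator 1 ∈
        LinearMap.range E.simpleFunction := by
    intro s hs
    induction s, hs using Set.Finite.induction_on with
    | empty =>
      intro _
      simpa using E.indicator_mem_range_simpleFunction (E.univ_mem_projectionSets hess)
    | @insert α s _ _ ih =>
      intro h0
      have h1 := ih fun β hβ => h0 β (Set.mem_insert_of_mem _ hβ)
      have h2 := E.indicator_mem_range_simpleFunction
        (E.range_mem_projectionSets (h0 α (Set.mem_insert _ _)))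
      by_cases hv : v ∈ E.range α
      · convert E.mul_mem_range_simpleFunction h1 h2 using 1
        ext w
        simp only [Set.indicator_apply, Pi.mul_apply, Set.mem_ofPred_eq, Set.forall_mem_insert, hv]
        split_ifs <;> simp_all
      -- The condition `w ∉ r(α)` multiplies the indicator `f` obtained so far by `1 - 1_{r(α)}`,
      -- giving `f - f · 1_{r(α)}`.
      · convert Submodule.sub_mem _ h1 (E.mul_mem_range_simpleFunction h1 h2) using 1
        ext w
        simp only [Set.indicator_apply, Pi.mul_apply, Pi.sub_apply, Set.mem_ofPred_eq,
          Set.forall_mem_insert, hv]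
        split_ifs <;> simp_all
  have hT : {α : List A | α ≠ [] ∧ α.length ≤ l}.Finite :=
    (List.finite_length_le A l).subset fun α h => h.2
  convert key _ hT fun α h => h.1 using 2
  ext w
  simp only [genVertexSet, Set.mem_ofPred_eq, genVertex_eq_iff, Set.ext_iff, mem_received_iff]
  constructor
  · intro h α hα
    have := h α
    simpa [hα, range] using this
  · intro h α
    by_cases hα : α ≠ [] ∧ α.length ≤ l
    · have := h α hα
      simpa [hα, range] using this
    · tauto

/-- Coefficients which express the indicator function of a generalised vertex as a linear
combination of indicator functions of sets in `𝓔^{0,-}`. -/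
def genVertexCoeff [Finite A] (hess : E.Essential) {l : ℕ} (P : E.GenVertex l) :
    E.projectionSets →₀ ℂ :=
  (E.indicator_genVertexSet_mem_range_simpleFunction hess P).choose

theorem simpleFunction_genVertexCoeff [Finite A] (hess : E.Essential) {l : ℕ} (P : E.GenVertex l) :
    E.simpleFunction (E.genVertexCoeff hess P) = (E.genVertexSet P).indicator 1 :=
  (E.indicator_genVertexSet_mem_range_simpleFunction hess P).choose_spec

end LabelledGraph

namespace LabelledGraph

variable {A : Type u} {E : LabelledGraph A}

/-! ### The linear extension of a representation of a labelled space -/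

namespace IsRepresentation

variable {B : Type u} [NonUnitalCStarAlgebra B] {p : E.projectionSets → B} {S : A → B}

theorem mul_eq (hR : E.IsRepresentation p S) (X Y : E.projectionSets) :
    p X * p Y = p ⟨X.1 ∩ Y.1, E.inter_mem_projectionSets X.2 Y.2⟩ := hR.inter _ _ _ rfl

theorem union_eq (hR : E.IsRepresentation p S) (X Y : E.projectionSets) :
    p ⟨X.1 ∪ Y.1, E.union_mem_projectionSets X.2 Y.2⟩ = p X + p Y - p X * p Y := by
  rw [hR.mul_eq, hR.union X Y ⟨X.1 ∩ Y.1, E.inter_mem_projectionSets X.2 Y.2⟩ _ rfl rfl]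

theorem proj_comm (hR : E.IsRepresentation p S) (X Y : E.projectionSets) :
    p X * p Y = p Y * p X := by
  rw [hR.inter X Y ⟨X.1 ∩ Y.1, E.inter_mem_projectionSets X.2 Y.2⟩ rfl,
    hR.inter Y X ⟨X.1 ∩ Y.1, E.inter_mem_projectionSets X.2 Y.2⟩ (Set.inter_comm _ _)]

/-- Each `X` splits `U \ W` into `(U ∩ X) \ W`, where `1_X` is constantly `1`, and `U \ (W ∪ X)`,
where it vanishes. The induction absorbs the coefficient of `X` into the constant `k` on the first
piece and drops it on the second. Pairs `U, W` stand in for differences, which may lie outside the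
collection. -/
theorem linear_relation_aux (hR : E.IsRepresentation p S) (c : E.projectionSets → ℂ)
    (s : Finset E.projectionSets) : ∀ (k : ℂ) (U W : E.projectionSets),
      (∀ v ∈ U.1 \ W.1, k + ∑ X ∈ s, c X * X.1.indicator 1 v = 0) →
      k • (p U - p U * p W) + (p U - p U * p W) * ∑ X ∈ s, c X • p X = 0 := by
  classical
  induction s using Finset.induction_on with
  | empty =>
    intro k U W h
    simp only [Finset.sum_empty, add_zero, mul_zero] at h ⊢
    -- Either the difference is empty and `p_U - p_U p_W = 0`, or a point of it forces `k = 0`.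
    by_cases hUW : U.1 ⊆ W.1
    · rw [hR.inter U W U (Set.inter_eq_left.2 hUW).symm, sub_self, smul_zero]
    · obtain ⟨v, hv, hv'⟩ := Set.not_subset.1 hUW
      rw [h v ⟨hv, hv'⟩, zero_smul]
  | insert X s hX ih =>
    intro k U W h
    simp only [Finset.sum_insert hX] at h ⊢
    have h1 := ih (k + c X) ⟨U.1 ∩ X.1, E.inter_mem_projectionSets U.2 X.2⟩ W fun v hv => by
      have := h v ⟨hv.1.1, hv.2⟩
      rw [Set.indicator_of_mem hv.1.2, Pi.one_apply, mul_one] at this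
      rw [add_assoc, this]
    have h2 := ih k U ⟨W.1 ∪ X.1, E.union_mem_projectionSets W.2 X.2⟩ fun v hv => by
      have := h v ⟨hv.1, fun h' => hv.2 (Or.inl h')⟩
      rw [Set.indicator_of_notMem fun h' => hv.2 (Or.inr h'), mul_zero, zero_add] at this
      exact this
    rw [← hR.mul_eq] at h1
    rw [hR.union_eq] at h2
    have e1 : p U - p U * p W = (p U * p X - p U * p X * p W) +
        (p U - p U * (p W + p X - p W * p X)) := by
      rw [mul_sub, mul_add, hR.proj_comm W X, ← mul_assoc]
      abel
    have e2 : (p U - p U * p W) * p X = p U * p X - p U * p X * p W := by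
      rw [sub_mul, mul_assoc, mul_assoc, hR.proj_comm X W]
    have e3 : (p U - p U * p W) * (c X • p X) = c X • (p U * p X - p U * p X * p W) := by
      rw [mul_smul_comm, e2]
    rw [mul_add, e3, e1, add_mul, smul_add]
    rw [add_smul] at h1
    calc _ = (k • (p U * p X - p U * p X * p W) + c X • (p U * p X - p U * p X * p W) +
          (p U * p X - p U * p X * p W) * ∑ X ∈ s, c X • p X) +
          (k • (p U - p U * (p W + p X - p W * p X)) +
          (p U - p U * (p W + p X - p W * p X)) * ∑ X ∈ s, c X • p X) := by abel
      _ = 0 := by rw [h1, h2, add_zero]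

/-- The projection of the set of all vertices acts as a unit. -/
theorem univ_mul (hR : E.IsRepresentation p S) (h1 : Set.univ ∈ E.projectionSets)
    (X : E.projectionSets) : p ⟨Set.univ, h1⟩ * p X = p X :=
  hR.inter _ _ _ (Set.univ_inter _).symm

/-- A linear combination of the projections vanishes if the corresponding linear combination of
indicator functions does. -/
theorem linearCombination_eq_zero [Finite A] (hess : E.Essential) (hR : E.IsRepresentation p S)
    {c : E.projectionSets →₀ ℂ} (hc : E.simpleFunction c = 0) :
    Finsupp.linearCombination ℂ p c = 0 := by
  have h1 := E.univ_mem_projectionSets hess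
  -- Take `U = E⁰`, `W = ∅`, `k = 0`, so that `U \ W` is everything.
  have h := hR.linear_relation_aux c c.support 0 ⟨Set.univ, h1⟩
    ⟨∅, E.empty_mem_projectionSets⟩ fun v _ => by
      have := congrFun hc v
      rw [simpleFunction, Finsupp.linearCombination_apply, Finsupp.sum, Finset.sum_apply] at this
      simpa using this
  rw [hR.empty ⟨∅, _⟩ rfl, mul_zero, sub_zero, zero_smul, zero_add, Finset.mul_sum] at h
  rw [Finsupp.linearCombination_apply, Finsupp.sum, ← h]
  exact Finset.sum_congr rfl fun X _ => by rw [mul_smul_comm, hR.univ_mul]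

/-- This makes `1_X ↦ p_X` a well-defined linear map on the span of the indicators. Identities
between linear combinations of projections can from here on be checked on functions, and the choice
of `genVertexCoeff` is harmless. -/
theorem linearCombination_congr [Finite A] (hess : E.Essential) (hR : E.IsRepresentation p S)
    {c d : E.projectionSets →₀ ℂ} (h : E.simpleFunction c = E.simpleFunction d) :
    Finsupp.linearCombination ℂ p c = Finsupp.linearCombination ℂ p d := by
  rw [← sub_eq_zero, ← map_sub]
  exact hR.linearCombination_eq_zero hess (by rw [map_sub, h, sub_self])

theorem univ_mul_linearCombination (hR : E.IsRepresentation p S)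
    (h1 : Set.univ ∈ E.projectionSets) (c : E.projectionSets →₀ ℂ) :
    p ⟨Set.univ, h1⟩ * Finsupp.linearCombination ℂ p c = Finsupp.linearCombination ℂ p c := by
  induction c using Finsupp.induction_linear with
  | zero => simp
  | add c d hc hd => rw [map_add, mul_add, hc, hd]
  | single X k => rw [Finsupp.linearCombination_single, mul_smul_comm, hR.univ_mul]

theorem linearCombination_mul_univ (hR : E.IsRepresentation p S)
    (h1 : Set.univ ∈ E.projectionSets) (c : E.projectionSets →₀ ℂ) :
    Finsupp.linearCombination ℂ p c * p ⟨Set.univ, h1⟩ = Finsupp.linearCombination ℂ p c := by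
  induction c using Finsupp.induction_linear with
  | zero => simp
  | add c d hc hd => rw [map_add, add_mul, hc, hd]
  | single X k =>
    rw [Finsupp.linearCombination_single, smul_mul_assoc, hR.proj_comm, hR.univ_mul]

/-- One `b` serves both identities, so with `linearCombination_congr` the extension of `1_X ↦ p_X`
is multiplicative. -/
theorem exists_linearCombination_mul (hR : E.IsRepresentation p S) (c d : E.projectionSets →₀ ℂ) :
    ∃ b, E.simpleFunction b = E.simpleFunction c * E.simpleFunction d ∧
      Finsupp.linearCombination ℂ p b =
        Finsupp.linearCombination ℂ p c * Finsupp.linearCombination ℂ p d := by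
  induction c using Finsupp.induction_linear with
  | zero => exact ⟨0, by simp⟩
  | add c c' hc hc' =>
    obtain ⟨b, h1, h2⟩ := hc
    obtain ⟨b', h1', h2'⟩ := hc'
    exact ⟨b + b', by simp only [map_add, h1, h1', add_mul], by
      simp only [map_add, h2, h2', add_mul]⟩
  | single X k =>
    induction d using Finsupp.induction_linear with
    | zero => exact ⟨0, by simp⟩
    | add c c' hc hc' =>
      obtain ⟨b, h1, h2⟩ := hc
      obtain ⟨b', h1', h2'⟩ := hc'
      exact ⟨b + b', by simp only [map_add, h1, h1', mul_add], by
        simp only [map_add, h2, h2', mul_add]⟩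
    | single Y m =>
      refine ⟨Finsupp.single ⟨X.1 ∩ Y.1, E.inter_mem_projectionSets X.2 Y.2⟩ (k * m), ?_, ?_⟩
      · simp only [simpleFunction_single, smul_mul_smul_comm]
        exact congrArg _ Set.inter_indicator_one
      · simp only [Finsupp.linearCombination_single, smul_mul_smul_comm, hR.mul_eq]

theorem exists_linearCombination_star (hR : E.IsRepresentation p S) (c : E.projectionSets →₀ ℂ) :
    ∃ b, E.simpleFunction b = star (E.simpleFunction c) ∧
      Finsupp.linearCombination ℂ p b = star (Finsupp.linearCombination ℂ p c) := by
  induction c using Finsupp.induction_linear with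
  | zero => exact ⟨0, by simp⟩
  | add c c' hc hc' =>
    obtain ⟨b, h1, h2⟩ := hc
    obtain ⟨b', h1', h2'⟩ := hc'
    exact ⟨b + b', by simp only [map_add, h1, h1', star_add], by
      simp only [map_add, h2, h2', star_add]⟩
  | single X k =>
    refine ⟨Finsupp.single X (star k), ?_, ?_⟩
    · classical
      rw [simpleFunction_single, simpleFunction_single, star_smul]
      congr 1
      ext v
      simp only [Pi.star_apply, Set.indicator_apply, Pi.one_apply]
      split_ifs <;> simp
    · rw [Finsupp.linearCombination_single, Finsupp.linearCombination_single, star_smul,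
        (hR.projection X).isSelfAdjoint.star_eq]

/-- Moving `p_X` past `s_a` leaves `p_{r(a)} p_{r(X,a)}`, and `r(X,a) ⊆ r(a)`. -/
theorem star_mul_proj_mul (hR : E.IsRepresentation p S) (a : A)
    (X : E.projectionSets) : star (S a) * p X * S a =
      p ⟨E.relRange X.1 [a], E.relRange_mem_projectionSets X.2 (by simp)⟩ := by
  rw [mul_assoc, hR.proj_mul a X ⟨_, E.relRange_mem_projectionSets X.2 (by simp)⟩ rfl, ← mul_assoc,
    hR.star_mul_self a ⟨_, E.range_mem_projectionSets (by simp)⟩ rfl]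
  refine hR.inter _ _ _ (Set.inter_eq_right.2 ?_).symm
  rintro w ⟨v, -, h⟩
  exact ⟨v, h⟩

theorem exists_linearCombination_transfer (hE : E.LeftResolving) (hR : E.IsRepresentation p S)
    (a : A) (c : E.projectionSets →₀ ℂ) :
    ∃ b, E.simpleFunction b = E.transfer a (E.simpleFunction c) ∧
      Finsupp.linearCombination ℂ p b = star (S a) * Finsupp.linearCombination ℂ p c * S a := by
  induction c using Finsupp.induction_linear with
  | zero => exact ⟨0, by simp⟩
  | add c c' hc hc' =>
    obtain ⟨b, h1, h2⟩ := hc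
    obtain ⟨b', h1', h2'⟩ := hc'
    exact ⟨b + b', by simp only [map_add, h1, h1'], by
      simp only [map_add, h2, h2', mul_add, add_mul]⟩
  | single X k =>
    refine ⟨Finsupp.single ⟨E.relRange X.1 [a], E.relRange_mem_projectionSets X.2 (by simp)⟩ k,
      ?_, ?_⟩
    · rw [simpleFunction_single, simpleFunction_single, map_smul, E.transfer_indicator hE]
    · rw [Finsupp.linearCombination_single, Finsupp.linearCombination_single, mul_smul_comm,
        smul_mul_assoc, hR.star_mul_proj_mul]

theorem commute_linearCombination (hR : E.IsRepresentation p S) (a : A)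
    (c : E.projectionSets →₀ ℂ) :
    S a * star (S a) * Finsupp.linearCombination ℂ p c =
      Finsupp.linearCombination ℂ p c * (S a * star (S a)) := by
  induction c using Finsupp.induction_linear with
  | zero => simp
  | add c d hc hd => rw [map_add, mul_add, add_mul, hc, hd]
  | single X k =>
    rw [Finsupp.linearCombination_single, mul_smul_comm, smul_mul_assoc]
    congr 1
    have h := hR.proj_mul a X ⟨_, E.relRange_mem_projectionSets X.2 (by simp)⟩ rfl
    -- The adjoint of `p_X s_a = s_a p_{r(X,a)}` turns both sides into `s_a p_{r(X,a)} s_a⋆`.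
    have h' := congrArg star h
    rw [StarMul.star_mul, StarMul.star_mul, (hR.projection _).isSelfAdjoint.star_eq,
      (hR.projection _).isSelfAdjoint.star_eq] at h'
    rw [mul_assoc, h', ← mul_assoc, ← mul_assoc, h]

theorem partialIsometry_mul_range (hR : E.IsRepresentation p S) (a : A) :
    S a * p ⟨E.range [a], E.range_mem_projectionSets (by simp)⟩ = S a := by
  rw [← hR.star_mul_self a _ rfl, ← mul_assoc]
  exact hR.partialIsometry a

theorem univ_mul_partialIsometry (hR : E.IsRepresentation p S)
    (h1 : Set.univ ∈ E.projectionSets) (a : A) : p ⟨Set.univ, h1⟩ * S a = S a := by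
  rw [hR.proj_mul a _ ⟨_, E.range_mem_projectionSets (by simp)⟩ (E.range_eq_relRange_univ [a]),
    ← hR.star_mul_self a _ rfl, ← mul_assoc]
  exact hR.partialIsometry a

theorem partialIsometry_mul_univ (hR : E.IsRepresentation p S)
    (h1 : Set.univ ∈ E.projectionSets) (a : A) : S a * p ⟨Set.univ, h1⟩ = S a := by
  rw [← hR.partialIsometry_mul_range a, mul_assoc, hR.proj_comm, hR.univ_mul]

theorem sum_partialIsometry_mul_star [Fintype A] (hR : E.IsRepresentation p S)
    (h1 : Set.univ ∈ E.projectionSets) : ∑ a, S a * star (S a) = p ⟨Set.univ, h1⟩ := by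
  rw [hR.sum ⟨Set.univ, h1⟩ (fun a => ⟨_, E.range_mem_projectionSets (α := [a]) (by simp)⟩)
    fun a => E.range_eq_relRange_univ [a]]
  simp only [hR.partialIsometry_mul_range]
  rw [finsum_mem_eq_finite_toFinset_sum _ (Set.toFinite _)]
  -- The sum may run over all labels: if no edge is labelled `a`, then `r(a) = ∅` and `s_a = s_a
  -- p_{r(a)} = 0`.
  refine (Finset.sum_subset (Finset.subset_univ _) fun a _ ha => ?_).symm
  rw [← hR.partialIsometry_mul_range a, hR.empty, mul_zero, zero_mul]
  refine Set.eq_empty_of_forall_notMem fun w hw => ha ?_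
  replace hw : w ∈ E.range [a] := hw
  rw [range_eq_relRange_univ, mem_relRange_singleton] at hw
  obtain ⟨e, -, -, he⟩ := hw
  simpa [emittedLabels] using ⟨e, he⟩

end IsRepresentation

end LabelledGraph

namespace LabelledGraph

variable {A : Type u} {E : LabelledGraph A}

/-! ### Representatives of generalised vertices -/

/-- A vertex in a generalised vertex. -/
def GenVertex.rep {l : ℕ} (P : E.GenVertex l) : E.V := Quotient.out P

theorem genVertex_rep {l : ℕ} (P : E.GenVertex l) : E.genVertex l P.rep = P := Quotient.out_eq P

theorem received_rep_genVertex (l : ℕ) (v : E.V) :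
    E.received l (E.genVertex l v).rep = E.received l v :=
  E.genVertex_eq_iff.1 (genVertex_rep _)

theorem simpleFunction_sum_genVertexCoeff [Finite A] (hess : E.Essential) {l : ℕ}
    [Fintype (E.GenVertex l)] (k : E.GenVertex l → ℂ) :
    E.simpleFunction (∑ P, k P • E.genVertexCoeff hess P) = fun v => k (E.genVertex l v) := by
  classical
  ext v
  simp [map_sum, simpleFunction_genVertexCoeff, genVertexSet, Set.indicator_apply]

variable [Fintype A] (hess : E.Essential) (hE : E.LeftResolving)

/-! ### The λ-graph system of a labelled graph -/

/-- The λ-graph system of a labelled graph. -/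
abbrev lambdaGraph : LambdaGraphSystem A := (E.symbolicMatrixSystem hess hE).lambdaGraphSystem

-- Level `n` of the λ-graph system is `Ω_{n+1}`, hence the shifts by one and two here and below.
open Classical in
theorem inclusion_genVertex (n : ℕ) (P : E.GenVertex (n + 1)) (w : E.V) :
    (lambdaGraph hess hE).inclusion n P (E.genVertex (n + 2) w) =
      if E.genVertex (n + 1) w = P then 1 else 0 := by
  refine if_congr ?_ rfl rfl
  refine ((E.symbolicMatrixSystem hess hE).parent_eq_iff n P (E.genVertex (n + 2) w)).trans ?_
  change E.inclusionMatrix (n + 1) P (E.genVertex (n + 2) w) ≠ 0 ↔ E.genVertex (n + 1) w = P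
  rw [inclusionMatrix_eq]
  simp

open Classical in
theorem transition_genVertex (n : ℕ) (P : E.GenVertex (n + 1)) (a : A) (w : E.V) :
    (lambdaGraph hess hE).transition n P a (E.genVertex (n + 2) w) =
      if ∃ e, E.genVertex (n + 1) (E.s e) = P ∧ E.r e = w ∧ E.label e = a then 1 else 0 := by
  refine if_congr ?_ rfl rfl
  have h1 : (E.symbolicMatrixSystem hess hE).M n P (E.genVertex (n + 2) w) a =
      E.edgeCount P w a := rfl
  have h2 : E.edgeCount P w a ≠ 0 ↔
      ∃ e, E.genVertex (n + 1) (E.s e) = P ∧ E.r e = w ∧ E.label e = a := by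
    rw [edgeCount_eq E hE]
    simp
  rw [← h2, ← h1]
  constructor
  · rintro ⟨⟨i, j, ⟨b, hb⟩, k⟩, rfl, h, rfl⟩
    replace h : j = E.genVertex (n + 2) w := h
    subst h
    exact Finsupp.mem_support_iff.1 hb
  · intro h
    exact ⟨⟨P, E.genVertex (n + 2) w, ⟨a, Finsupp.mem_support_iff.2 h⟩,
      ⟨0, Nat.pos_of_ne_zero h⟩⟩, rfl, rfl, rfl⟩

/-- This translates the relation for `t_a⋆ E_P t_a` into functions: both sides at `w` ask for an
`a`-edge into `w` with source in `P`. -/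
theorem transfer_indicator_genVertexSet (n : ℕ) (P : E.GenVertex (n + 1)) (a : A) :
    E.transfer a ((E.genVertexSet P).indicator 1) =
      fun w => ((lambdaGraph hess hE).transition n P a (E.genVertex (n + 2) w) : ℂ) := by
  classical
  ext w
  rw [transition_genVertex, transfer_indicator E hE, Set.indicator_apply]
  simp only [mem_relRange_singleton, Nat.cast_ite, Nat.cast_one, Nat.cast_zero, Pi.one_apply]
  rfl

/-! ### From representations of the labelled space to representations of the λ-graph system -/

namespace IsRepresentation

variable {B : Type u} [NonUnitalCStarAlgebra B] {p : E.projectionSets → B} {S : A → B}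

theorem isStarProjection_linearCombination (hess : E.Essential) (hR : E.IsRepresentation p S)
    {X : Set E.V} {c : E.projectionSets →₀ ℂ} (hc : E.simpleFunction c = X.indicator 1) :
    IsStarProjection (Finsupp.linearCombination ℂ p c) := by
  classical
  constructor
  · obtain ⟨b, h1, h2⟩ := hR.exists_linearCombination_mul c c
    rw [IsIdempotentElem, ← h2]
    refine hR.linearCombination_congr hess ?_
    rw [h1, hc, ← Set.inter_indicator_one, Set.inter_self]
  · obtain ⟨b, h1, h2⟩ := hR.exists_linearCombination_star c
    rw [IsSelfAdjoint, ← h2]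
    refine hR.linearCombination_congr hess ?_
    rw [h1, hc]
    ext v
    simp only [Pi.star_apply, Set.indicator_apply, Pi.one_apply]
    split_ifs <;> simp

theorem sum_smul_linearCombination {l : ℕ} [Fintype (E.GenVertex l)] (k : E.GenVertex l → ℂ) :
    ∑ P, k P • Finsupp.linearCombination ℂ p (E.genVertexCoeff hess P) =
      Finsupp.linearCombination ℂ p (∑ P, k P • E.genVertexCoeff hess P) := by
  simp [map_sum]

theorem sum_nsmul_linearCombination {l : ℕ} [Fintype (E.GenVertex l)] (k : E.GenVertex l → ℕ) :
    ∑ P, k P • Finsupp.linearCombination ℂ p (E.genVertexCoeff hess P) =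
      Finsupp.linearCombination ℂ p (∑ P, (k P : ℂ) • E.genVertexCoeff hess P) := by
  rw [← sum_smul_linearCombination]
  exact Finset.sum_congr rfl fun P _ => (Nat.cast_smul_eq_nsmul ℂ _ _).symm

/-- `E_P` is the image of the indicator of `P` under the linear extension of `1_X ↦ p_X`. The
relations involving only the `E_P` and the one for `t_a⋆ E_P t_a` are then identities of functions.
-/
theorem isRepresentation_lambdaGraph (hR : E.IsRepresentation p S) :
    (lambdaGraph hess hE).IsRepresentation
      (B := cornerSubalgebra (hR.projection ⟨Set.univ, E.univ_mem_projectionSets hess⟩))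
      (fun a => ⟨S a, hR.univ_mul_partialIsometry _ a, hR.partialIsometry_mul_univ _ a⟩)
      (fun n P => ⟨Finsupp.linearCombination ℂ p (E.genVertexCoeff hess (l := n + 1) P),
        hR.univ_mul_linearCombination _ _, hR.linearCombination_mul_univ _ _⟩) where
  partialIsometry a := Subtype.ext (hR.partialIsometry a)
  projection n P := by
    have h := hR.isStarProjection_linearCombination hess
      (E.simpleFunction_genVertexCoeff hess (l := n + 1) P)
    exact ⟨Subtype.ext h.1, Subtype.ext h.2⟩
  sum_range := by
    refine Subtype.ext ?_
    rw [AddSubmonoidClass.coe_finsetSum]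
    exact hR.sum_partialIsometry_mul_star _
  sum_proj n := by
    refine Subtype.ext ?_
    rw [AddSubmonoidClass.coe_finsetSum]
    let _ : Fintype (E.GenVertex (n + 1)) := (lambdaGraph hess hE).fintype n
    have h := sum_smul_linearCombination (p := p) hess (l := n + 1) fun _ => 1
    simp only [one_smul] at h
    refine h.trans ?_
    have h' := hR.linearCombination_congr hess (c := ∑ P : E.GenVertex (n + 1),
      E.genVertexCoeff hess P)
      (d := Finsupp.single ⟨Set.univ, E.univ_mem_projectionSets hess⟩ 1) (by
        have := simpleFunction_sum_genVertexCoeff hess (l := n + 1) fun _ => 1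
        simp only [one_smul] at this
        rw [this, simpleFunction_single]
        ext v
        simp)
    rw [h', Finsupp.linearCombination_single, one_smul]
    rfl
  proj_eq n := fun P : E.GenVertex (n + 1) => by
    classical
    refine Subtype.ext ?_
    rw [AddSubmonoidClass.coe_finsetSum]
    let _ : Fintype (E.GenVertex (n + 2)) := (lambdaGraph hess hE).fintype (n + 1)
    refine Eq.trans ?_ (sum_nsmul_linearCombination (p := p) hess (l := n + 2)
      ((lambdaGraph hess hE).inclusion n P)).symm
    refine hR.linearCombination_congr hess ?_
    rw [simpleFunction_sum_genVertexCoeff, simpleFunction_genVertexCoeff]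
    ext v
    rw [inclusion_genVertex, Set.indicator_apply]
    simp only [Nat.cast_ite, Nat.cast_one, Nat.cast_zero, Pi.one_apply]
    rfl
  commute n a P := Subtype.ext (hR.commute_linearCombination a _)
  star_mul_mul n a := fun P : E.GenVertex (n + 1) => by
    refine Subtype.ext ?_
    rw [AddSubmonoidClass.coe_finsetSum]
    let _ : Fintype (E.GenVertex (n + 2)) := (lambdaGraph hess hE).fintype (n + 1)
    refine Eq.trans ?_ (sum_nsmul_linearCombination (p := p) hess (l := n + 2)
      ((lambdaGraph hess hE).transition n P a)).symm
    obtain ⟨b, h1, h2⟩ := hR.exists_linearCombination_transfer hE a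
      (E.genVertexCoeff hess (l := n + 1) P)
    refine h2.symm.trans (hR.linearCombination_congr hess ?_)
    rw [h1, simpleFunction_sum_genVertexCoeff, simpleFunction_genVertexCoeff]
    exact transfer_indicator_genVertexSet hess hE n P a

end IsRepresentation

/-- The representation of the λ-graph system in a corner of a C⋆-algebra with a representation of the
labelled space. -/
def Representation.toLambdaGraph (R : E.Representation) : (lambdaGraph hess hE).Representation where
  carrier := cornerSubalgebra
    (R.isRepresentation.projection ⟨Set.univ, E.univ_mem_projectionSets hess⟩)
  t := _
  F := _
  isRepresentation := R.isRepresentation.isRepresentation_lambdaGraph hess hE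

end LabelledGraph

namespace LabelledGraph

variable {A : Type u} {E : LabelledGraph A}

/-! ### From representations of the λ-graph system to representations of the labelled space -/

/-- The function `f` is constant on generalised vertices of level `l`. -/
def IsLevelFunction (E : LabelledGraph A) (l : ℕ) (f : E.V → ℂ) : Prop :=
  ∀ v w, E.received l v = E.received l w → f v = f w

theorem IsLevelFunction.mono {l m : ℕ} (hlm : l ≤ m) {f : E.V → ℂ} (h : E.IsLevelFunction l f) :
    E.IsLevelFunction m f := fun v w hvw => h v w (received_of_le hlm hvw)

theorem IsLevelFunction.apply_rep {l : ℕ} {f : E.V → ℂ} (h : E.IsLevelFunction l f) (v : E.V) :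
    f (E.genVertex l v).rep = f v := h _ _ (received_rep_genVertex l v)

theorem Saturated.isLevelFunction {l : ℕ} {X : Set E.V} (h : E.Saturated l X) :
    E.IsLevelFunction l (X.indicator 1) := by
  classical
  intro v w hvw
  rw [Set.indicator_apply, Set.indicator_apply]
  exact if_congr ⟨h v w hvw, h w v hvw.symm⟩ rfl rfl

/-- A level at which a set in `𝓔^{0,-} ∪ {∅}` is a union of generalised vertices. -/
def level (hE : E.LeftResolving) (X : E.projectionSets) : ℕ := (exists_saturated hE X.2).choose

theorem isLevelFunction_indicator (hE : E.LeftResolving) (X : E.projectionSets) {m : ℕ}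
    (hm : level hE X ≤ m) : E.IsLevelFunction m (X.1.indicator 1) :=
  ((exists_saturated hE X.2).choose_spec.mono hm).isLevelFunction

variable [Fintype A] {hess : E.Essential} {hE : E.LeftResolving}

variable (hess hE) in
/-- The vertex of level `n` of the λ-graph system which contains a vertex of the graph. -/
def lambdaVertex (n : ℕ) (v : E.V) : (lambdaGraph hess hE).V n := E.genVertex (n + 1) v

/-- A vertex of the graph which is contained in a vertex of the λ-graph system. -/
def lambdaRep {n : ℕ} (P : (lambdaGraph hess hE).V n) : E.V := GenVertex.rep (l := n + 1) P

theorem lambdaVertex_lambdaRep {n : ℕ} (P : (lambdaGraph hess hE).V n) :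
    lambdaVertex hess hE n (lambdaRep P) = P := genVertex_rep _

theorem IsLevelFunction.apply_lambdaRep {n : ℕ} {f : E.V → ℂ} (h : E.IsLevelFunction (n + 1) f)
    (v : E.V) : f (lambdaRep (lambdaVertex hess hE n v)) = f v := h.apply_rep v

open Classical in
theorem inclusion_lambdaVertex (n : ℕ) (P : (lambdaGraph hess hE).V n) (w : E.V) :
    (lambdaGraph hess hE).inclusion n P (lambdaVertex hess hE (n + 1) w) =
      if lambdaVertex hess hE n w = P then 1 else 0 := inclusion_genVertex hess hE n P w

open Classical in
theorem transition_lambdaVertex (n : ℕ) (P : (lambdaGraph hess hE).V n) (a : A) (w : E.V) :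
    (lambdaGraph hess hE).transition n P a (lambdaVertex hess hE (n + 1) w) =
      if ∃ e, lambdaVertex hess hE n (E.s e) = P ∧ E.r e = w ∧ E.label e = a then 1 else 0 :=
  transition_genVertex hess hE n P a w

/-! ### Functions on the vertices evaluated in a representation of the λ-graph system -/

/-- The linear combination of the elements `F n P` whose coefficients are the values of a function on the vertices. -/
def levelSum {B : Type*} [AddCommMonoid B] [Module ℂ B]
    (F : ∀ n, (lambdaGraph hess hE).V n → B) (n : ℕ) (f : E.V → ℂ) : B :=
  ∑ P : (lambdaGraph hess hE).V n, f (lambdaRep P) • F n P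

section levelSum

variable {B : Type*} [AddCommMonoid B] [Module ℂ B] (F : ∀ n, (lambdaGraph hess hE).V n → B) (n : ℕ)

theorem levelSum_add (f g : E.V → ℂ) :
    levelSum F n (f + g) = levelSum F n f + levelSum F n g := by
  simp [levelSum, add_smul, Finset.sum_add_distrib]

theorem levelSum_smul (k : ℂ) (f : E.V → ℂ) :
    levelSum F n (k • f) = k • levelSum F n f := by
  simp [levelSum, mul_smul, Finset.smul_sum]

theorem levelSum_zero : levelSum F n (0 : E.V → ℂ) = 0 := by
  simp [levelSum]

theorem levelSum_indicator_genVertexSet (P : (lambdaGraph hess hE).V n) :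
    levelSum F n ((E.genVertexSet (l := n + 1) P).indicator 1) = F n P := by
  classical
  have hP : ∀ Q : (lambdaGraph hess hE).V n,
      lambdaRep Q ∈ E.genVertexSet (l := n + 1) P ↔ Q = P := fun Q =>
    ⟨fun h => (lambdaVertex_lambdaRep Q).symm.trans h, fun h => (lambdaVertex_lambdaRep Q).trans h⟩
  rw [levelSum, Finset.sum_eq_single P]
  · rw [Set.indicator_of_mem ((hP P).2 rfl), Pi.one_apply, one_smul]
  · intro Q _ hQ
    rw [Set.indicator_of_notMem fun h => hQ ((hP Q).1 h), zero_smul]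
  · intro h
    exact (h (Finset.mem_univ _)).elim

end levelSum

section

variable {B : Type u} [CStarAlgebra B] {t : A → B} {F : ∀ n, (lambdaGraph hess hE).V n → B}

theorem levelSum_sub (n : ℕ) (f g : E.V → ℂ) :
    levelSum F n (f - g) = levelSum F n f - levelSum F n g := by
  simp [levelSum, sub_smul, Finset.sum_sub_distrib]

theorem levelSum_one (hR : (lambdaGraph hess hE).IsRepresentation t F) (n : ℕ) :
    levelSum F n 1 = 1 := by
  simpa [levelSum] using hR.sum_proj n

/-- The `F n P` are orthogonal, so multiplication is pointwise at the representatives. No regularity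
of `f` or `g` is needed, as no other values enter. -/
theorem levelSum_mul (hR : (lambdaGraph hess hE).IsRepresentation t F) (n : ℕ) (f g : E.V → ℂ) :
    levelSum F n (f * g) = levelSum F n f * levelSum F n g := by
  rw [levelSum, levelSum, levelSum, Finset.sum_mul_sum]
  refine Finset.sum_congr rfl fun P _ => ?_
  rw [Finset.sum_eq_single P]
  · rw [smul_mul_smul_comm, (hR.projection n P).isIdempotentElem.eq, Pi.mul_apply]
  · intro Q _ hQ
    rw [smul_mul_smul_comm, mul_eq_zero_of_sum_eq_one (hR.projection n) (hR.sum_proj n) hQ.symm,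
      smul_zero]
  · intro h
    exact (h (Finset.mem_univ _)).elim

theorem levelSum_star (hR : (lambdaGraph hess hE).IsRepresentation t F) (n : ℕ) (f : E.V → ℂ) :
    levelSum F n (star f) = star (levelSum F n f) := by
  rw [levelSum, levelSum, star_sum]
  exact Finset.sum_congr rfl fun P _ => by
    rw [star_smul, (hR.projection n P).isSelfAdjoint.star_eq, Pi.star_apply]

/-- Each `F n P` is the sum of the `F (n + 1) Q` with `Q ⊆ P`. The representatives of `P` and `Q`
may differ, which is why `f` has to be constant on `P`. -/
theorem levelSum_succ (hR : (lambdaGraph hess hE).IsRepresentation t F) {n : ℕ} {f : E.V → ℂ}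
    (hf : E.IsLevelFunction (n + 1) f) : levelSum F (n + 1) f = levelSum F n f := by
  classical
  have h : ∀ Q : (lambdaGraph hess hE).V (n + 1), ∑ P : (lambdaGraph hess hE).V n, f (lambdaRep P) •
      (lambdaGraph hess hE).inclusion n P Q • F (n + 1) Q = f (lambdaRep Q) • F (n + 1) Q := by
    intro Q
    obtain ⟨w, hw⟩ : ∃ w, w = lambdaRep Q := ⟨_, rfl⟩
    have hQ : Q = lambdaVertex hess hE (n + 1) w := by rw [hw, lambdaVertex_lambdaRep]
    rw [Finset.sum_eq_single (lambdaVertex hess hE n w)]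
    · have h1 : (lambdaGraph hess hE).inclusion n (lambdaVertex hess hE n w) Q = 1 := by
        rw [hQ, inclusion_lambdaVertex, if_pos rfl]
      rw [h1, one_smul, ← hw, hf.apply_lambdaRep]
    · intro P _ hP
      have h1 : (lambdaGraph hess hE).inclusion n P Q = 0 := by
        rw [hQ, inclusion_lambdaVertex, if_neg (Ne.symm hP)]
      rw [h1, zero_smul, smul_zero]
    · intro h
      exact (h (Finset.mem_univ _)).elim
  rw [levelSum, levelSum]
  simp only [hR.proj_eq n, Finset.smul_sum]
  rw [Finset.sum_comm]
  exact Finset.sum_congr rfl fun Q _ => (h Q).symm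

theorem levelSum_of_le (hR : (lambdaGraph hess hE).IsRepresentation t F) {n m : ℕ} (hnm : n ≤ m)
    {f : E.V → ℂ} (hf : E.IsLevelFunction (n + 1) f) : levelSum F m f = levelSum F n f := by
  induction m, hnm using Nat.le_induction with
  | base => rfl
  | succ m h ih => rw [levelSum_succ hR (hf.mono (Nat.succ_le_succ h)), ih]

/-- For a class `Q` with representative `w`, at most one `P` contributes: the class of the source of
the unique `a`-edge into `w`. Its coefficient is the value of `f` at that source, that is, the
transferred function at `w`. -/
theorem star_mul_levelSum_mul (hR : (lambdaGraph hess hE).IsRepresentation t F) {n : ℕ}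
    {f : E.V → ℂ} (hf : E.IsLevelFunction (n + 1) f) (a : A) :
    star (t a) * levelSum F n f * t a = levelSum F (n + 1) (E.transfer a f) := by
  classical
  have h : ∀ Q : (lambdaGraph hess hE).V (n + 1), ∑ P : (lambdaGraph hess hE).V n, f (lambdaRep P) •
      (lambdaGraph hess hE).transition n P a Q • F (n + 1) Q =
        E.transfer a f (lambdaRep Q) • F (n + 1) Q := by
    intro Q
    obtain ⟨w, hw⟩ : ∃ w, w = lambdaRep Q := ⟨_, rfl⟩
    have hQ : Q = lambdaVertex hess hE (n + 1) w := by rw [hw, lambdaVertex_lambdaRep]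
    have htr : ∀ P : (lambdaGraph hess hE).V n, (lambdaGraph hess hE).transition n P a Q =
        if ∃ e, lambdaVertex hess hE n (E.s e) = P ∧ E.r e = w ∧ E.label e = a then 1 else 0 := by
      intro P
      rw [hQ, transition_lambdaVertex]
    rw [← hw]
    by_cases he : ∃ e, E.r e = w ∧ E.label e = a
    · obtain ⟨e, h1, h2⟩ := he
      rw [Finset.sum_eq_single (lambdaVertex hess hE n (E.s e))]
      · rw [htr, if_pos ⟨e, rfl, h1, h2⟩, one_smul, hf.apply_lambdaRep, ← h1, ← h2,
          transfer_apply_range E hE]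
      · intro P _ hP
        rw [htr, if_neg, zero_smul, smul_zero]
        rintro ⟨e', h0, h1', h2'⟩
        rw [hE e' e (h1'.trans h1.symm) (h2'.trans h2.symm)] at h0
        exact hP h0.symm
      · intro h
        exact (h (Finset.mem_univ _)).elim
    · rw [transfer_apply_eq_zero E f he, zero_smul]
      refine Finset.sum_eq_zero fun P _ => ?_
      rw [htr, if_neg, zero_smul, smul_zero]
      rintro ⟨e, -, h⟩
      exact he ⟨e, h⟩
  rw [levelSum, levelSum, Finset.mul_sum, Finset.sum_mul]
  simp only [mul_smul_comm, smul_mul_assoc, hR.star_mul_mul n a, Finset.smul_sum]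
  rw [Finset.sum_comm]
  exact Finset.sum_congr rfl fun Q _ => h Q

theorem mul_star_mul_levelSum (hR : (lambdaGraph hess hE).IsRepresentation t F) (n : ℕ)
    (f : E.V → ℂ) (a : A) :
    t a * star (t a) * levelSum F n f = levelSum F n f * (t a * star (t a)) := by
  rw [levelSum, Finset.mul_sum, Finset.sum_mul]
  exact Finset.sum_congr rfl fun P _ => by rw [mul_smul_comm, smul_mul_assoc, hR.commute]

/-! ### The projections of sets of vertices and their relations -/

/-- The projection of a set in `𝓔^{0,-} ∪ {∅}`. -/
def levelProjection {B : Type*} [AddCommMonoid B] [Module ℂ B]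
    (F : ∀ n, (lambdaGraph hess hE).V n → B) (X : E.projectionSets) : B :=
  levelSum F (level hE X) (X.1.indicator 1)

/-- The index `level hE X` stands for `Ω_{level + 1}`, one step finer than necessary, so saturation
at level `0` needs no separate case. Sets can then be compared at any common higher level. -/
theorem levelProjection_eq (hR : (lambdaGraph hess hE).IsRepresentation t F) (X : E.projectionSets)
    {m : ℕ} (hm : level hE X ≤ m) : levelProjection F X = levelSum F m (X.1.indicator 1) :=
  (levelSum_of_le hR hm (isLevelFunction_indicator hE X (Nat.le_succ _))).symm

/-- Only finitely many sets occur in `c`, so one level resolves them all. -/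
theorem linearCombination_levelProjection (hR : (lambdaGraph hess hE).IsRepresentation t F)
    (c : E.projectionSets →₀ ℂ) : ∃ n, ∀ m, n ≤ m →
      Finsupp.linearCombination ℂ (levelProjection F) c = levelSum F m (E.simpleFunction c) := by
  induction c using Finsupp.induction_linear with
  | zero => exact ⟨0, fun m _ => by rw [map_zero, map_zero, levelSum_zero]⟩
  | add c d hc hd =>
    obtain ⟨n, hn⟩ := hc
    obtain ⟨n', hn'⟩ := hd
    refine ⟨max n n', fun m hm => ?_⟩
    rw [map_add, map_add, levelSum_add, hn m ((le_max_left _ _).trans hm),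
      hn' m ((le_max_right _ _).trans hm)]
  | single X k =>
    refine ⟨level hE X, fun m hm => ?_⟩
    rw [Finsupp.linearCombination_single, simpleFunction_single, levelSum_smul,
      levelProjection_eq hR X hm]

theorem star_mul_levelProjection_mul (hR : (lambdaGraph hess hE).IsRepresentation t F)
    (a : A) {X Y : E.projectionSets} (hY : Y.1 = E.relRange X.1 [a]) :
    star (t a) * levelProjection F X * t a = levelProjection F Y := by
  obtain ⟨n, hX', hY'⟩ : ∃ n, level hE X ≤ n ∧ level hE Y ≤ n + 1 :=
    ⟨max (level hE X) (level hE Y), le_max_left _ _, (le_max_right _ _).trans (Nat.le_succ _)⟩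
  rw [levelProjection_eq hR X hX', levelProjection_eq hR Y hY',
    star_mul_levelSum_mul hR (isLevelFunction_indicator hE X (hX'.trans (Nat.le_succ _))),
    transfer_indicator E hE, hY]

theorem isRepresentation_levelProjection (hR : (lambdaGraph hess hE).IsRepresentation t F) :
    E.IsRepresentation (levelProjection F) t where
  projection X := by
    classical
    constructor
    · rw [IsIdempotentElem, levelProjection, ← levelSum_mul hR, ← Set.inter_indicator_one,
        Set.inter_self]
    · rw [IsSelfAdjoint, levelProjection, ← levelSum_star hR]
      congr 1
      ext v
      simp only [Pi.star_apply, Set.indicator_apply, Pi.one_apply]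
      split_ifs <;> simp
  partialIsometry := hR.partialIsometry
  empty X hX := by
    rw [levelProjection, hX, Set.indicator_empty]
    exact levelSum_zero F _
  inter X Y Z hZ := by
    obtain ⟨n, h1, h2, h3⟩ : ∃ n, level hE X ≤ n ∧ level hE Y ≤ n ∧ level hE Z ≤ n :=
      ⟨level hE X + level hE Y + level hE Z, by omega, by omega, by omega⟩
    rw [levelProjection_eq hR X h1, levelProjection_eq hR Y h2, levelProjection_eq hR Z h3,
      ← levelSum_mul hR, hZ, Set.inter_indicator_one]
  union X Y Z W hZ hW := by
    classical
    obtain ⟨n, h1, h2, h3, h4⟩ : ∃ n, level hE X ≤ n ∧ level hE Y ≤ n ∧ level hE Z ≤ n ∧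
        level hE W ≤ n :=
      ⟨level hE X + level hE Y + level hE Z + level hE W, by omega, by omega, by omega, by omega⟩
    rw [levelProjection_eq hR X h1, levelProjection_eq hR Y h2, levelProjection_eq hR Z h3,
      levelProjection_eq hR W h4, ← levelSum_add, ← levelSum_sub, hW, hZ]
    congr 1
    ext v
    by_cases hX : v ∈ X.1 <;> by_cases hY : v ∈ Y.1 <;> simp [hX, hY]
  proj_mul a X Y hY := by
    rw [← star_mul_levelProjection_mul hR a hY]
    -- Insert `t_a = t_a t_a⋆ t_a` and commute the range projection past the projection of `X`.
    calc levelProjection F X * t a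
        = levelProjection F X * (t a * star (t a) * t a) := by
          rw [show t a * star (t a) * t a = t a from hR.partialIsometry a]
      _ = t a * star (t a) * levelProjection F X * t a := by
          rw [← mul_assoc, levelProjection, mul_star_mul_levelSum hR]
      _ = _ := by simp only [mul_assoc]
  star_mul_self a X hX := by
    have h1 := E.univ_mem_projectionSets hess
    -- Here `r(a) = r(E⁰, a)`, and the projection of `E⁰` is `1`.
    rw [← star_mul_levelProjection_mul hR a (X := ⟨Set.univ, h1⟩)
      (hX.trans (E.range_eq_relRange_univ [a])), levelProjection, Set.indicator_univ,
      levelSum_one hR, mul_one]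
  star_mul a b hab := star_mul_eq_zero_of_sum_eq_one hR.partialIsometry hR.sum_range hab
  sum X Y hY := by
    classical
    rw [finsum_mem_eq_finite_toFinset_sum _ (Set.toFinite _),
      Finset.sum_subset (Finset.subset_univ _)]
    -- Multiply by `1 = ∑ t_a t_a⋆`. Each summand becomes `t_a (t_a⋆ p_X t_a) t_a⋆` by idempotence
    -- and commutation.
    · conv_lhs => rw [← one_mul (levelProjection F X), ← hR.sum_range, Finset.sum_mul]
      refine Finset.sum_congr rfl fun a _ => ?_
      rw [← star_mul_levelProjection_mul hR a (hY a)]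
      have h : t a * star (t a) * (t a * star (t a)) = t a * star (t a) := by
        rw [← mul_assoc]
        exact congrArg (· * star (t a)) (hR.partialIsometry a)
      calc t a * star (t a) * levelProjection F X
          = t a * star (t a) * (t a * star (t a)) * levelProjection F X := by rw [h]
        _ = t a * star (t a) * (levelProjection F X * (t a * star (t a))) := by
          rw [mul_assoc, levelProjection, mul_star_mul_levelSum hR]
        _ = _ := by simp only [mul_assoc]
    -- A label not emitted by `X` contributes zero, since `r(X,a) = ∅`.
    · intro a _ ha
      have hYa : (Y a).1 = ∅ := by
        rw [hY]
        refine Set.eq_empty_of_forall_notMem fun w hw => ha ?_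
        obtain ⟨e, h1, -, h2⟩ := E.mem_relRange_singleton.1 hw
        exact (Set.Finite.mem_toFinset _).2 ⟨e, h1, h2⟩
      rw [levelProjection, hYa, Set.indicator_empty]
      exact (congrArg (t a * · * star (t a)) (levelSum_zero F _)).trans (by simp)

end

variable (hess hE)

/-- The representation of the labelled space in a C⋆-algebra with a representation of the λ-graph
system. -/
def representationOfLambdaGraph (R : (lambdaGraph hess hE).Representation) : E.Representation where
  carrier := R.carrier
  p := levelProjection R.F
  S := R.t
  isRepresentation := isRepresentation_levelProjection R.isRepresentation

/-! ### The isomorphism -/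

/-- The map of `ℓ^∞`-products induced by `representationOfLambdaGraph`. -/
def toLambdaGraphProduct : lp (fun R : E.Representation => R.carrier) ∞ →⋆ₙₐ[ℂ]
    lp (fun R : (lambdaGraph hess hE).Representation => R.carrier) ∞ :=
  lpInftyMap (representationOfLambdaGraph hess hE)
    fun R => NonUnitalStarAlgHom.id ℂ R.carrier

/-- The map of `ℓ^∞`-products induced by `Representation.toLambdaGraph`. -/
def ofLambdaGraphProduct : lp (fun R : (lambdaGraph hess hE).Representation => R.carrier) ∞ →⋆ₙₐ[ℂ]
    lp (fun R : E.Representation => R.carrier) ∞ :=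
  lpInftyMap (Representation.toLambdaGraph hess hE) fun R =>
    cornerSubtype (R.isRepresentation.projection ⟨Set.univ, E.univ_mem_projectionSets hess⟩)

theorem lp_coeFn_linearCombination {α ι : Type*} {B : ι → Type*} [∀ i, NormedAddCommGroup (B i)]
    [∀ i, NormedSpace ℂ (B i)] (x : α → lp B ∞) (c : α →₀ ℂ) (i : ι) :
    Finsupp.linearCombination ℂ x c i = Finsupp.linearCombination ℂ (fun a => x a i) c := by
  induction c using Finsupp.induction_linear with
  | zero => simp
  | add c d hc hd => rw [map_add, map_add, lp.coeFn_add, Pi.add_apply, hc, hd]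
  | single a k =>
    rw [Finsupp.linearCombination_single, Finsupp.linearCombination_single, lp.coeFn_smul,
      Pi.smul_apply]

theorem lp_coeFn_levelSum {ι : Type*} {B : ι → Type*} [∀ i, NormedAddCommGroup (B i)]
    [∀ i, NormedSpace ℂ (B i)] (F : ∀ n, (lambdaGraph hess hE).V n → lp B ∞) (n : ℕ) (f : E.V → ℂ)
    (i : ι) : levelSum F n f i = levelSum (hess := hess) (hE := hE) (fun n P => F n P i) n f := by
  rw [levelSum, lp.coeFn_sum, Finset.sum_apply]
  rfl

theorem toLambdaGraphProduct_universalP (X : E.projectionSets) :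
    toLambdaGraphProduct hess hE (E.universalP X) =
      levelProjection (lambdaGraph hess hE).universalF X := by
  ext R
  exact (lp_coeFn_levelSum hess hE (lambdaGraph hess hE).universalF (level hE X)
    (X.1.indicator 1) R).symm

theorem ofLambdaGraphProduct_universalF (n : ℕ) (P : E.GenVertex (n + 1)) :
    ofLambdaGraphProduct hess hE ((lambdaGraph hess hE).universalF n P) =
      Finsupp.linearCombination ℂ E.universalP (E.genVertexCoeff hess P) := by
  ext R
  exact (lp_coeFn_linearCombination E.universalP (E.genVertexCoeff hess P) R).symm

theorem ofLambdaGraphProduct_toLambdaGraphProduct_universalP (X : E.projectionSets) :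
    ofLambdaGraphProduct hess hE (toLambdaGraphProduct hess hE (E.universalP X)) =
      E.universalP X := by
  let _ : Fintype (E.GenVertex (level hE X + 1)) := (lambdaGraph hess hE).fintype (level hE X)
  rw [toLambdaGraphProduct_universalP, levelProjection, levelSum, map_sum]
  ext R
  rw [lp.coeFn_sum, Finset.sum_apply]
  -- As `X` is a union of classes, `1_X` is the sum of the class indicators weighted by its values
  -- at representatives.
  have h := R.isRepresentation.linearCombination_congr hess
    (c := ∑ P : E.GenVertex (level hE X + 1), X.1.indicator 1 P.rep • E.genVertexCoeff hess P)
    (d := Finsupp.single X 1) (by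
      rw [simpleFunction_sum_genVertexCoeff, simpleFunction_single, one_smul]
      ext v
      exact (isLevelFunction_indicator hE X (Nat.le_succ _)).apply_rep v)
  rw [Finsupp.linearCombination_single, one_smul, ← IsRepresentation.sum_smul_linearCombination]
    at h
  exact h

theorem toLambdaGraphProduct_ofLambdaGraphProduct_universalF (n : ℕ) (P : E.GenVertex (n + 1)) :
    toLambdaGraphProduct hess hE (ofLambdaGraphProduct hess hE
      ((lambdaGraph hess hE).universalF n P)) = (lambdaGraph hess hE).universalF n P := by
  rw [ofLambdaGraphProduct_universalF]
  ext R
  obtain ⟨m, hm⟩ := linearCombination_levelProjection R.isRepresentation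
    (E.genVertexCoeff hess P)
  have hf : E.IsLevelFunction (n + 1) ((E.genVertexSet P).indicator 1) :=
    Saturated.isLevelFunction fun v w hvw hv => (E.genVertex_eq_iff.2 hvw.symm).trans hv
  -- At a level beyond both `n` and `m`, the image of the chosen coefficients is `levelSum` of the
  -- indicator of `P`, which descends to level `n`, where it is `F n P`.
  have h := hm (max n m) (le_max_right _ _)
  rw [simpleFunction_genVertexCoeff, levelSum_of_le R.isRepresentation (le_max_left n m) hf] at h
  refine Eq.trans ?_ (h.trans (levelSum_indicator_genVertexSet R.F n P))
  exact lp_coeFn_linearCombination (B := fun R : E.Representation => R.carrier) _ _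
    (representationOfLambdaGraph hess hE R)

end LabelledGraph

end

open LabelledGraph in
theorem proposition3p6 {A : Type u} [Fintype A] (E : LabelledGraph A)
    (hess : E.Essential) (hE : E.LeftResolving) :
    Nonempty (E.cstarAlgebra ≃⋆ₐ[ℂ]
      (E.symbolicMatrixSystem hess hE).lambdaGraphSystem.cstarAlgebra) := by
  refine nonempty_starAlgEquiv_of_generators (toLambdaGraphProduct hess hE)
    (ofLambdaGraphProduct hess hE) ?_ ?_ ?_ ?_
  · rintro _ (⟨X, rfl⟩ | ⟨a, rfl⟩)
    · rw [toLambdaGraphProduct_universalP]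
      refine NonUnitalStarSubalgebra.le_topologicalClosure _ ?_
      rw [levelProjection, levelSum]
      refine sum_mem fun P _ => SMulMemClass.smul_mem _ ?_
      exact NonUnitalStarAlgebra.subset_adjoin ℂ _
        (Or.inr (Set.mem_iUnion.2 ⟨level hE X, P, rfl⟩))
    -- The generators `s_a` and `t_a` correspond by definition, in every coordinate.
    · exact NonUnitalStarSubalgebra.le_topologicalClosure _
        (NonUnitalStarAlgebra.subset_adjoin ℂ _ (Or.inl ⟨a, rfl⟩))
  · rintro _ (⟨a, rfl⟩ | h)
    · exact NonUnitalStarSubalgebra.le_topologicalClosure _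
        (NonUnitalStarAlgebra.subset_adjoin ℂ _ (Or.inr ⟨a, rfl⟩))
    · obtain ⟨n, P, rfl⟩ := Set.mem_iUnion.1 h
      have h := ofLambdaGraphProduct_universalF hess hE n P
      rw [Finsupp.linearCombination_apply] at h
      refine h.symm ▸ NonUnitalStarSubalgebra.le_topologicalClosure _
        (sum_mem fun X _ => SMulMemClass.smul_mem _ ?_)
      exact NonUnitalStarAlgebra.subset_adjoin ℂ _ (Or.inl ⟨X, rfl⟩)
  · rintro _ (⟨X, rfl⟩ | ⟨a, rfl⟩)
    · exact ofLambdaGraphProduct_toLambdaGraphProduct_universalP hess hE X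
    · rfl
  · rintro _ (⟨a, rfl⟩ | h)
    · rfl
    · obtain ⟨n, P, rfl⟩ := Set.mem_iUnion.1 h
      exact toLambdaGraphProduct_ofLambdaGraphProduct_universalF hess hE n P
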